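/- Let $\beta\in(0,1)$ and let $f_0:[0,1]\to\mathbb R$ be a profile such that $f_0(r)=\tilde f_0(r^2)$ with $\tilde f_0\in C^{2,\beta}([0,1])$, and $\inf_{r\in(0,1]}f_0'(r)/r>0$. Set $$\kappa_2=\int_0^1 sf_0(s)\,ds,\qquad \widehat\Omega_n=\kappa_2-\frac{n+1}{n}\int_0^1 s^{2n+1}f_0(s)\,ds\quad(n\ge1),$$ $$\mu^0_\Omega(r)=\frac{f_0'(r)}{r\left(\Omega-\int_0^1 sf_0(sr)\,ds\right)},\qquad \nu_\Omega=|\mu_\Omega^0| ,$$ and let $F_{n,\Omega}$ be the unique $C^2$ solution on $[0,1]$ of $$F''+\tfrac{2n+1}{r}F'+\mu^0_\Omega F=0,\qquad F(0)=1.$$ Define the dispersion function $$\zeta_n(\Omega)=F_{n,\Omega}(1)\Big(\Omega-\tfrac{n}{n+1}\kappa_2\Big)+\int_0^1F_{n,\Omega}(s)s^{2n+1}\big(f_0(s)-2\Omega\big)ds,$$ and, for $m\ge1$ and $\Omega$ given, with $H_m[h](1)=\int_0^1 s^{m+1}h(s)\,ds$, $$G_m(r)=m\Omega r^{m+1}+r^{m-1}\kappa_2-(m+1)r^{m-1}\int_0^r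 sf_0(s)ds+\frac{m+1}{r^{m+1}}\int_0^r s^{2m+1}f_0(s)ds,$$ $$A_m[h]=-\frac{H_m[h](1)}{2G_m(1)},$$ $$h_m^\star(r)=r^mF_{m,\Omega}(r)\mu^0_{\Omega}(r)\int_1^r\frac{1}{F_{m,\Omega}^2(s)s^{2m+1}}\int_0^sF_{m,\Omega}(\tau)\tau^{2m+1}\Big(\Omega-\tfrac{f_0(\tau)}2\Big)d\tau\,ds,$$ $$d_m^\star(r)=h_m^\star(r)\frac{r}{f_0'(r)}+\frac{A_m[h_m^\star]}{G_m(1)}\,rG_m(r)-A_m[h_m^\star]\,r^{m+2},$$ $$\mathbb I_m=\mathbb I_m(\Omega)=\int_0^1\nu_{\Omega}(r)\,r^{m+1}F_{m,\Omega}(r)\,d_m^\star(r)\,dr .$$ (i) Assume $f_0>0$ on $[0,1]$. Let $m$ be an integer with $3\le m\le\frac1{10}\frac{f_0(0)}{f_0(1)-f_0(0)}$ and let $\Omega_m\in\big(\widehat\Omega_m,\frac{m\kappa_2}{m+1}\big)$ satisfy $\zeta_m(\Omega_m)=0$. Then $\mathbb I_m(\Omega_m)\ne0$. (ii) Assume $f_0<0$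 on $[0,1]$ and let $a\in(1,2)$. There is $m_0\ge1$ such that for every integer $m\ge m_0$ and every $\Omega_m\in(\widehat\Omega_m-m^{-a},\widehat\Omega_m)$ with $\zeta_m(\Omega_m)=0$ one has $\mathbb I_m(\Omega_m)\neq0$. Moreover $4(m+1)|\mathbb I_m(\Omega_m)|\to\infty$ as $m\to\infty$, uniformly over all such $\Omega_m$: for every $K\in\mathbb R$ there is $m_0\ge1$ such that $4(m+1)|\mathbb I_m(\Omega_m)|\ge K$ for all $m\ge m_0$ and all such $\Omega_m$. -/

import Mathlib

open Set

namespace RadialEuler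

noncomputable section

/-- `f₀(r) = f̃₀(r²)` on `[0,1]` with `f̃₀` of class `C^{2,β}` on `[0,1]`. -/
def SmoothProfile (β : ℝ) (f₀ : ℝ → ℝ) : Prop :=
  ∃ g : ℝ → ℝ, (∀ r ∈ Icc (0 : ℝ) 1, f₀ r = g (r ^ 2)) ∧
    ContDiffOn ℝ 2 g (Icc 0 1) ∧
    ∃ C : ℝ, ∀ x ∈ Icc (0 : ℝ) 1, ∀ y ∈ Icc (0 : ℝ) 1,
      |derivWithin (derivWithin g (Icc 0 1)) (Icc 0 1) x
        - derivWithin (derivWithin g (Icc 0 1)) (Icc 0 1) y| ≤ C * |x - y| ^ β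

/-- The derivative `f₀'` on `[0,1]` (one-sided at the end points). -/
def profileDeriv (f₀ : ℝ → ℝ) (r : ℝ) : ℝ := derivWithin f₀ (Icc 0 1) r

/-- `inf_{r ∈ (0,1]} f₀'(r) / r > 0`. -/
def MonotoneProfile (f₀ : ℝ → ℝ) : Prop :=
  ∃ c : ℝ, 0 < c ∧ ∀ r ∈ Ioc (0 : ℝ) 1, c ≤ profileDeriv f₀ r / r

/-- `κ₂ = ∫₀¹ s f₀(s) ds`. -/
def kappa₂ (f₀ : ℝ → ℝ) : ℝ := ∫ s in (0 : ℝ)..1, s * f₀ s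

/-- The singular values
`Ω̂ₙ = ∫₀¹ s f₀(s) ds - (n+1)/n ∫₀¹ s^{2n+1} f₀(s) ds`, for `n ≥ 1`. -/
def singularValue (f₀ : ℝ → ℝ) (n : ℕ) : ℝ :=
  kappa₂ f₀ - ((n : ℝ) + 1) / n * ∫ s in (0 : ℝ)..1, s ^ (2 * n + 1) * f₀ s

/-- `μ_Ω⁰(r) = f₀'(r) / (r (Ω - ∫₀¹ s f₀(s r) ds))`, for `r ∈ (0,1]`. -/
def mu (f₀ : ℝ → ℝ) (Ω r : ℝ) : ℝ :=
  profileDeriv f₀ r / (r * (Ω - ∫ s in (0 : ℝ)..1, s * f₀ (s * r)))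

/-- `ν_Ω = |μ_Ω⁰|`. -/
def nu (f₀ : ℝ → ℝ) (Ω r : ℝ) : ℝ := |mu f₀ Ω r|

/-- `F` is of class `C²` on `[0,1]`, `F(0) = 1`, and
`F'' + (2n+1)/r F' + μ_Ω⁰ F = 0` for `0 < r ≤ 1`. -/
def IsSturmSolution (f₀ : ℝ → ℝ) (n : ℕ) (Ω : ℝ) (F : ℝ → ℝ) : Prop :=
  ContDiffOn ℝ 2 F (Icc 0 1) ∧ F 0 = 1 ∧
    ∀ r ∈ Ioc (0 : ℝ) 1,
      derivWithin (derivWithin F (Icc 0 1)) (Icc 0 1) r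
        + (2 * (n : ℝ) + 1) / r * derivWithin F (Icc 0 1) r
        + mu f₀ Ω r * F r = 0

open Classical in
/-- `F_{n,Ω}`: the `C²` solution on `[0,1]` of the normalized Sturm-Liouville equation. Only its
values on `[0,1]`, where it is unique, are used. -/
def sturm (f₀ : ℝ → ℝ) (n : ℕ) (Ω : ℝ) : ℝ → ℝ :=
  if h : ∃ F : ℝ → ℝ, IsSturmSolution f₀ n Ω F then h.choose else 0

/-- The dispersion function
`ζₙ(Ω) = F_{n,Ω}(1) (Ω - n/(n+1) ∫₀¹ s f₀(s) ds) + ∫₀¹ F_{n,Ω}(s) s^{2n+1} (f₀(s) - 2Ω) ds`. -/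
def zeta (f₀ : ℝ → ℝ) (n : ℕ) (Ω : ℝ) : ℝ :=
  sturm f₀ n Ω 1 * (Ω - (n : ℝ) / (n + 1) * kappa₂ f₀)
    + ∫ s in (0 : ℝ)..1, sturm f₀ n Ω s * s ^ (2 * n + 1) * (f₀ s - 2 * Ω)

/-- `Hₙ[h](r) = r^{2n} ∫_r^1 s^{1-n} h(s) ds + ∫_0^r s^{n+1} h(s) ds`. -/
def Hop (n : ℕ) (h : ℝ → ℝ) (r : ℝ) : ℝ :=
  r ^ (2 * n) * (∫ s in r..1, s ^ (1 - (n : ℤ)) * h s) + ∫ s in (0 : ℝ)..r, s ^ (n + 1) * h s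

/-- `Gₙ(r) = nΩ r^{n+1} + r^{n-1} ∫₀¹ s f₀ - (n+1) r^{n-1} ∫_0^r s f₀
+ (n+1)/r^{n+1} ∫_0^r s^{2n+1} f₀`, for `n ≥ 1`. -/
def Gfun (f₀ : ℝ → ℝ) (n : ℕ) (Ω r : ℝ) : ℝ :=
  n * Ω * r ^ (n + 1) + r ^ (n - 1) * kappa₂ f₀
    - (n + 1) * r ^ (n - 1) * (∫ s in (0 : ℝ)..r, s * f₀ s)
    + (n + 1) / r ^ (n + 1) * ∫ s in (0 : ℝ)..r, s ^ (2 * n + 1) * f₀ s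

/-- `Aₙ[h] = - Hₙ[h](1) / (2 Gₙ(1))`. -/
def Aop (f₀ : ℝ → ℝ) (n : ℕ) (Ω : ℝ) (h : ℝ → ℝ) : ℝ :=
  -(Hop n h 1 / (2 * Gfun f₀ n Ω 1))

/-- The radial part `h_m^⋆` of the generator of the kernel. -/
def hStar (f₀ : ℝ → ℝ) (m : ℕ) (Ω r : ℝ) : ℝ :=
  r ^ m * sturm f₀ m Ω r * mu f₀ Ω r *
    ∫ s in (1 : ℝ)..r, 1 / (sturm f₀ m Ω s ^ 2 * s ^ (2 * m + 1)) *
      ∫ τ in (0 : ℝ)..s, sturm f₀ m Ω τ * τ ^ (2 * m + 1) * (Ω - f₀ τ / 2)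

/-- `d_m^⋆(r) = h_m^⋆(r) r / f₀'(r) + A_m[h_m^⋆]/G_m(1) r G_m(r) - A_m[h_m^⋆] r^{m+2}`. -/
def dStar (f₀ : ℝ → ℝ) (m : ℕ) (Ω r : ℝ) : ℝ :=
  hStar f₀ m Ω r * (r / profileDeriv f₀ r)
    + Aop f₀ m Ω (hStar f₀ m Ω) / Gfun f₀ m Ω 1 * r * Gfun f₀ m Ω r
    - Aop f₀ m Ω (hStar f₀ m Ω) * r ^ (m + 2)

/-- The transversality integral `𝕀_m = ∫₀¹ ν_Ω(r) r^{m+1} F_{m,Ω}(r) d_m^⋆(r) dr`. -/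
def transInt (f₀ : ℝ → ℝ) (m : ℕ) (Ω : ℝ) : ℝ :=
  ∫ r in (0 : ℝ)..1, nu f₀ Ω r * r ^ (m + 1) * sturm f₀ m Ω r * dStar f₀ m Ω r

end

end RadialEuler

open Set

namespace RadialEuler

noncomputable section

/-! ### Weighted averages and solvability of the singular radial equation. -/

section

/-! Write `Φ` for the iterated integral in `h_m^⋆` (`varConst`), so that `h_m^⋆ = r^m F μ Φ`. Then
`FΦ` solves the radial equation with right-hand side `Ω - f₀/2`. Integrating that equation over
`[0,1]` (`IsRadialSolution.integral_mul_varConst`) expresses `H_m[h_m^⋆](1)` through the very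
integrals occurring in `ζ_m`. At a zero of `ζ_m` everything collapses to `A_m[h_m^⋆] = 1/(4(m+1))`
(`IsProfileSlope.Aop_hStar`). Moreover `r G_m(r) - r^{m+2} G_m(1) = r^m N(r)` with `N` independent
of `Ω`. Hence, with `w(r) = ∫₀¹ s f₀(sr) ds`, `𝕀_m` is the integral of `|μ| r^{2m+1} F` against the
bracket `FΦ/(Ω - w) + N/(4(m+1) G_m(1))` (`IsProfileSlope.transInt_eq`), and `G_m(1) = m(Ω - Ω̂_m)`.

For positive profiles `Ω - w < 0`, so `μ ≤ 0` and `F` is nondecreasing and at least `1`. With `f₀`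
nearly constant on the scale `1/m`, the first term of the bracket is at least `-2(1 - r²)/(4(m+1))`,
while `N ≥ κ₂(1 - r²)` and `3 G_m(1) < κ₂` make the second exceed `3(1 - r²)/(4(m+1))`. The
integrand is positive pointwise (`IsProfileSlope.transInt_pos`).

For negative profiles `Ω - w` is comparable to `1/m + 1 - r²`. The coefficient `μ` may be as large
as `m`, but only near `r = 1`, and `F` stays within `1/3` of `1`
(`IsRadialSolution.abs_sub_one_le`). The first term contributes `O(1/m)` to `𝕀_m`; the integral of
`|μ| r^{2m+1} F N` is bounded below by a positive constant coming from a window of width `1/(4m)` at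
`r = 1`. Since `-m^{1-a} < G_m(1) < 0` with `a > 1`, dividing by `G_m(1)` drives `4(m+1) 𝕀_m` to
`-∞`. -/

lemma integral_pow_mul_const (k : ℕ) (C : ℝ) :
    ∫ t in (0 : ℝ)..1, t ^ k * C = C / (k + 1) := by
  rw [intervalIntegral.integral_mul_const, integral_pow]; simp; ring

/-- The weighted average `∫₀¹ tᵏ q(ts) dt` of `q` over `[0,s]`. -/
def wavg (k : ℕ) (q : ℝ → ℝ) (s : ℝ) : ℝ := ∫ t in (0 : ℝ)..1, t ^ k * q (t * s)

/-- Rescaling to `[0,1]` removes the singular factor `s^{-k}` at the origin: integrals from `0` are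
handled through averages that are continuous up to `s = 0`. -/
lemma pow_succ_mul_wavg (k : ℕ) (q : ℝ → ℝ) (s : ℝ) :
    s ^ (k + 1) * wavg k q s = ∫ τ in (0 : ℝ)..s, τ ^ k * q τ := by
  rcases eq_or_ne s 0 with rfl | hs
  · simp
  have h := intervalIntegral.integral_comp_mul_right (a := 0) (b := 1)
    (fun τ => τ ^ k * q τ) hs
  simp only [zero_mul, one_mul, smul_eq_mul] at h
  have h2 : (∫ x in (0 : ℝ)..1, (x * s) ^ k * q (x * s)) = s ^ k * wavg k q s := by
    rw [wavg, ← intervalIntegral.integral_const_mul]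
    congr 1; ext x; ring
  rw [h2] at h
  rw [pow_succ, mul_right_comm, h]
  field_simp

lemma inv_pow_mul_integral (k : ℕ) (q : ℝ → ℝ) (s : ℝ) :
    1 / s ^ k * ∫ τ in (0 : ℝ)..s, τ ^ k * q τ = s * wavg k q s := by
  rcases eq_or_ne s 0 with rfl | hs
  · simp
  rw [← pow_succ_mul_wavg, pow_succ]
  field_simp

lemma continuous_wavg (k : ℕ) {q : ℝ → ℝ} (hq : Continuous q) : Continuous (wavg k q) := by
  unfold wavg
  apply intervalIntegral.continuous_parametric_intervalIntegral_of_continuous'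
  simp only [Function.uncurry_def]
  fun_prop

lemma mul_mem_Icc {t s : ℝ} (ht : t ∈ Icc (0 : ℝ) 1) (hs : s ∈ Icc (0 : ℝ) 1) :
    t * s ∈ Icc (0 : ℝ) 1 :=
  ⟨mul_nonneg ht.1 hs.1, mul_le_one₀ ht.2 hs.1 hs.2⟩

lemma wavg_congr (k : ℕ) {q q' : ℝ → ℝ} (h : EqOn q q' (Icc 0 1)) {s : ℝ}
    (hs : s ∈ Icc (0 : ℝ) 1) : wavg k q s = wavg k q' s := by
  unfold wavg
  apply intervalIntegral.integral_congr
  intro t ht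
  rw [uIcc_of_le zero_le_one] at ht
  simp only [h (mul_mem_Icc ht hs)]

/-- The extension of a function on `[0,1]` by its end values. -/
def clampExt (q : ℝ → ℝ) (x : ℝ) : ℝ := q (projIcc 0 1 (zero_le_one' ℝ) x)

lemma clampExt_eq (q : ℝ → ℝ) : EqOn (clampExt q) q (Icc 0 1) := fun x hx => by
  rw [clampExt, projIcc_of_mem _ hx]

lemma continuous_clampExt {q : ℝ → ℝ} (hq : ContinuousOn q (Icc 0 1)) :
    Continuous (clampExt q) :=
  hq.comp_continuous (continuous_subtype_val.comp continuous_projIcc) fun x => (projIcc 0 1 _ x).2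

lemma continuousOn_wavg (k : ℕ) {q : ℝ → ℝ} (hq : ContinuousOn q (Icc 0 1)) :
    ContinuousOn (wavg k q) (Icc 0 1) :=
  (continuous_wavg k (continuous_clampExt hq)).continuousOn.congr
    fun _ hs => (wavg_congr k (clampExt_eq q) hs).symm

lemma intervalIntegrable_wavg (k : ℕ) {q : ℝ → ℝ} (hq : ContinuousOn q (Icc 0 1)) {s : ℝ}
    (hs : s ∈ Icc (0 : ℝ) 1) :
    IntervalIntegrable (fun t => t ^ k * q (t * s)) MeasureTheory.volume 0 1 := by
  apply ContinuousOn.intervalIntegrable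
  rw [uIcc_of_le zero_le_one]
  exact (by fun_prop : Continuous fun t : ℝ => t ^ k).continuousOn.mul
    (hq.comp (by fun_prop) fun t ht => mul_mem_Icc ht hs)

lemma abs_wavg_le (k : ℕ) {q : ℝ → ℝ} {s B : ℝ} (hs : 0 ≤ s)
    (hB : ∀ x ∈ Icc 0 s, |q x| ≤ B) : |wavg k q s| ≤ B / (k + 1) := by
  rw [← integral_pow_mul_const, ← Real.norm_eq_abs, wavg]
  apply intervalIntegral.norm_integral_le_of_norm_le zero_le_one
  · refine Filter.Eventually.of_forall fun t ht => ?_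
    rw [Real.norm_eq_abs, abs_mul, abs_of_nonneg (pow_nonneg ht.1.le k)]
    exact mul_le_mul_of_nonneg_left
      (hB _ ⟨mul_nonneg ht.1.le hs, mul_le_of_le_one_left hs ht.2⟩) (pow_nonneg ht.1.le k)
  · exact (by fun_prop : Continuous fun t : ℝ => t ^ k * B).intervalIntegrable _ _

lemma hasDerivAt_mul_wavg (k : ℕ) {q : ℝ → ℝ} (hq : Continuous q) (r : ℝ) :
    HasDerivAt (fun s => s * wavg k q s) (q r - k * wavg k q r) r := by
  rcases eq_or_ne r 0 with rfl | hr
  -- At the origin the difference quotient is the average itself, whose limit `q 0 / (k + 1)` equals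
  -- `q 0 - k * wavg k q 0`.
  · have h0 : wavg k q 0 = q 0 / (k + 1) := by
      simp only [wavg, mul_zero, integral_pow_mul_const]
    have h1 : q 0 - k * wavg k q 0 = wavg k q 0 := by rw [h0]; field_simp; ring
    rw [h1, hasDerivAt_iff_tendsto_slope]
    refine ((continuous_wavg k hq).tendsto 0 |>.mono_left nhdsWithin_le_nhds).congr' ?_
    filter_upwards [self_mem_nhdsWithin] with s hs
    have : s ≠ 0 := hs
    simp [slope_def_field]; field_simp
  · have h1 : HasDerivAt (fun s => ∫ τ in (0 : ℝ)..s, τ ^ k * q τ) (r ^ k * q r) r :=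
      (by fun_prop : Continuous fun τ : ℝ => τ ^ k * q τ).integral_hasStrictDerivAt 0 r
        |>.hasDerivAt
    have h2 := h1.div (hasDerivAt_pow k r) (pow_ne_zero k hr)
    have h3 : (fun s => s * wavg k q s) =
        fun s => (∫ τ in (0 : ℝ)..s, τ ^ k * q τ) / s ^ k := by
      ext s; rw [← inv_pow_mul_integral]; ring
    rw [h3]
    refine h2.congr_deriv ?_
    rw [← pow_succ_mul_wavg]
    rcases k with _ | k
    · simp
    · simp only [Nat.add_sub_cancel]
      field_simp
      ring

/-- The Picard operator of the radial equation `F'' + k/r F' + μF = 0`, `F(0) = 1`. -/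
def picard (k : ℕ) (μ : ℝ → ℝ) (u : C(Icc (0 : ℝ) 1, ℝ)) (r : ℝ) : ℝ :=
  1 - ∫ s in (0 : ℝ)..r, s * wavg k (fun x => μ x * IccExtend (zero_le_one' ℝ) u x) s

lemma continuous_mul_IccExtend {μ : ℝ → ℝ} (hμ : Continuous μ) (u : C(Icc (0 : ℝ) 1, ℝ)) :
    Continuous fun x => μ x * IccExtend (zero_le_one' ℝ) u x :=
  hμ.mul u.continuous.Icc_extend'

lemma hasDerivAt_picard (k : ℕ) {μ : ℝ → ℝ} (hμ : Continuous μ) (u : C(Icc (0 : ℝ) 1, ℝ))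
    (r : ℝ) : HasDerivAt (picard k μ u)
      (-(r * wavg k (fun x => μ x * IccExtend (zero_le_one' ℝ) u x) r)) r := by
  have := continuous_wavg k (continuous_mul_IccExtend hμ u)
  exact ((by fun_prop : Continuous fun s =>
    s * wavg k (fun x => μ x * IccExtend (zero_le_one' ℝ) u x) s).integral_hasStrictDerivAt 0 r
    |>.hasDerivAt).const_sub 1

/-- The Picard operator on `C([0,1])`. -/
def picardMap (k : ℕ) (μ : ℝ → ℝ) (hμ : Continuous μ) (u : C(Icc (0 : ℝ) 1, ℝ)) :
    C(Icc (0 : ℝ) 1, ℝ) :=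
  ⟨fun r => picard k μ u r, (continuous_iff_continuousAt.2 fun r =>
    (hasDerivAt_picard k hμ u r).continuousAt).comp continuous_subtype_val⟩

lemma wavg_sub (k : ℕ) {q q' : ℝ → ℝ} (hq : Continuous q) (hq' : Continuous q') (s : ℝ) :
    wavg k q s - wavg k q' s = wavg k (fun x => q x - q' x) s := by
  unfold wavg
  rw [← intervalIntegral.integral_sub]
  · congr 1; ext t; ring
  · exact (by fun_prop : Continuous fun t => t ^ k * q (t * s)).intervalIntegrable _ _
  · exact (by fun_prop : Continuous fun t => t ^ k * q' (t * s)).intervalIntegrable _ _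

/-- The usual Volterra estimate: each iteration integrates once more in `r`, which produces the
factorial. The singular term `k/r F'` costs nothing, because averaging against `t^k` does not
increase the supremum. -/
lemma abs_picardMap_iterate_sub_le (k : ℕ) {μ : ℝ → ℝ} (hμ : Continuous μ) {B : ℝ}
    (hB : ∀ x, |μ x| ≤ B) (u v : C(Icc (0 : ℝ) 1, ℝ)) (n : ℕ) (r : Icc (0 : ℝ) 1) :
    |(picardMap k μ hμ)^[n] u r - (picardMap k μ hμ)^[n] v r|
      ≤ (B * r) ^ n / n.factorial * dist u v := by
  induction n generalizing r with
  | zero => simpa [← Real.dist_eq] using ContinuousMap.dist_apply_le_dist r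
  | succ n ih =>
    rw [Function.iterate_succ_apply', Function.iterate_succ_apply']
    set U := (picardMap k μ hμ)^[n] u
    set V := (picardMap k μ hμ)^[n] v
    have hB0 : 0 ≤ B := (abs_nonneg _).trans (hB 0)
    have cU := continuous_mul_IccExtend hμ U
    have cV := continuous_mul_IccExtend hμ V
    have wU := continuous_wavg k cU
    have wV := continuous_wavg k cV
    have e : picardMap k μ hμ U r - picardMap k μ hμ V r = -∫ s in (0 : ℝ)..r,
        s * wavg k (fun x => μ x * IccExtend (zero_le_one' ℝ) U x
          - μ x * IccExtend (zero_le_one' ℝ) V x) s := by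
      simp only [picardMap, picard, ContinuousMap.coe_mk, ← wavg_sub k cU cV, mul_sub]
      rw [intervalIntegral.integral_sub]
      · ring
      · exact (by fun_prop : Continuous fun s => s * wavg k _ s).intervalIntegrable _ _
      · exact (by fun_prop : Continuous fun s => s * wavg k _ s).intervalIntegrable _ _
    rw [e, abs_neg]
    have hint : ∫ s in (0 : ℝ)..r, B ^ (n + 1) / n.factorial * dist u v * s ^ n
        = (B * r) ^ (n + 1) / (n + 1).factorial * dist u v := by
      rw [intervalIntegral.integral_const_mul, integral_pow, Nat.factorial_succ]
      push_cast; field_simp; simp; ring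
    rw [← hint, ← Real.norm_eq_abs]
    apply intervalIntegral.norm_integral_le_of_norm_le r.2.1
    · refine Filter.Eventually.of_forall fun s hs => ?_
      have hs1 : s ∈ Icc (0 : ℝ) 1 := ⟨hs.1.le, hs.2.trans r.2.2⟩
      rw [Real.norm_eq_abs, abs_mul, abs_of_nonneg hs1.1]
      have hb := abs_wavg_le k (q := fun x => μ x * IccExtend (zero_le_one' ℝ) U x
          - μ x * IccExtend (zero_le_one' ℝ) V x) (s := s)
        (B := B ^ (n + 1) / n.factorial * dist u v * s ^ n) hs1.1 (by
          intro x hx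
          have hx1 : x ∈ Icc (0 : ℝ) 1 := ⟨hx.1, hx.2.trans hs1.2⟩
          rw [IccExtend_of_mem _ _ hx1, IccExtend_of_mem _ _ hx1, ← mul_sub, abs_mul]
          calc |μ x| * |U ⟨x, hx1⟩ - V ⟨x, hx1⟩|
              ≤ B * ((B * x) ^ n / n.factorial * dist u v) :=
                mul_le_mul (hB x) (ih ⟨x, hx1⟩) (abs_nonneg _) hB0
            _ = B ^ (n + 1) / n.factorial * dist u v * x ^ n := by ring
            _ ≤ _ := by
                have := pow_le_pow_left₀ hx.1 hx.2 n
                gcongr)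
      have hnn : 0 ≤ B ^ (n + 1) / n.factorial * dist u v * s ^ n := by
        have := hs1.1; positivity
      calc s * |wavg k (fun x => μ x * IccExtend (zero_le_one' ℝ) U x
          - μ x * IccExtend (zero_le_one' ℝ) V x) s|
          ≤ 1 * (B ^ (n + 1) / n.factorial * dist u v * s ^ n) :=
            mul_le_mul hs1.2 (hb.trans (div_le_self hnn (by simp))) (abs_nonneg _) zero_le_one
        _ = _ := one_mul _
    · exact (by fun_prop : Continuous fun s : ℝ =>
        B ^ (n + 1) / n.factorial * dist u v * s ^ n).intervalIntegrable _ _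

/-- Since `B ^ n / n!` tends to `0`, some iterate is a contraction, and its unique fixed point is
also fixed by the map itself. -/
lemma exists_fixed_picardMap (k : ℕ) {μ : ℝ → ℝ} (hμ : Continuous μ) {B : ℝ}
    (hB : ∀ x, |μ x| ≤ B) : ∃ u, picardMap k μ hμ u = u := by
  have hB0 : 0 ≤ B := (abs_nonneg _).trans (hB 0)
  obtain ⟨n, hn⟩ := ((FloorSemiring.tendsto_pow_div_factorial_atTop B).eventually
    (gt_mem_nhds zero_lt_one)).exists
  have hc : ContractingWith ⟨B ^ n / n.factorial, by positivity⟩ (picardMap k μ hμ)^[n] := by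
    refine ⟨by exact_mod_cast hn, LipschitzWith.of_dist_le_mul fun u v => ?_⟩
    have hBn : 0 ≤ B ^ n / n.factorial := by positivity
    change _ ≤ B ^ n / n.factorial * dist u v
    rw [ContinuousMap.dist_le (mul_nonneg hBn dist_nonneg)]
    intro r
    rw [Real.dist_eq]
    refine (abs_picardMap_iterate_sub_le k hμ hB u v n r).trans ?_
    have h0 : 0 ≤ B * r := mul_nonneg hB0 r.2.1
    have h1 : B * r ≤ B := mul_le_of_le_one_right hB0 r.2.2
    gcongr
  exact ⟨_, hc.isFixedPt_fixedPoint_iterate⟩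

/-- The radial equation `F'' + k/r F' + μF = 0` has a `C²` solution on `[0,1]` with `F(0) = 1`. -/
theorem exists_radial_solution (k : ℕ) {μ : ℝ → ℝ} (hμ : ContinuousOn μ (Icc 0 1)) :
    ∃ F : ℝ → ℝ, ContDiffOn ℝ 2 F (Icc 0 1) ∧ F 0 = 1 ∧ ∀ r ∈ Ioc (0 : ℝ) 1,
      derivWithin (derivWithin F (Icc 0 1)) (Icc 0 1) r
        + k / r * derivWithin F (Icc 0 1) r + μ r * F r = 0 := by
  have hμ' := continuous_clampExt hμ
  obtain ⟨B, hB⟩ := isCompact_Icc.exists_bound_of_continuousOn hμ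
  obtain ⟨u, hu⟩ := exists_fixed_picardMap k hμ' (B := B) (fun x => by
    simpa [clampExt] using hB _ (projIcc 0 1 zero_le_one x).2)
  set q : ℝ → ℝ := fun x => clampExt μ x * IccExtend (zero_le_one' ℝ) u x
  have hq : Continuous q := continuous_mul_IccExtend hμ' u
  set F := picard k (clampExt μ) u
  have hF : ∀ r, HasDerivAt F (-(r * wavg k q r)) r := hasDerivAt_picard k hμ' u
  have hF' : ∀ r, HasDerivAt (fun r => -(r * wavg k q r)) (-(q r - k * wavg k q r)) r :=
    fun r => (hasDerivAt_mul_wavg k hq r).neg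
  have dF : deriv F = fun r => -(r * wavg k q r) := funext fun r => (hF r).deriv
  have ddF : deriv (fun r => -(r * wavg k q r)) = fun r => -(q r - k * wavg k q r) :=
    funext fun r => (hF' r).deriv
  have hw := continuous_wavg k hq
  have cF : ContDiff ℝ 2 F := by
    rw [show (2 : WithTop ℕ∞) = 1 + 1 by norm_num, contDiff_succ_iff_deriv]
    refine ⟨fun r => (hF r).differentiableAt, by simp, ?_⟩
    rw [dF, contDiff_one_iff_deriv, ddF]
    exact ⟨fun r => (hF' r).differentiableAt, by fun_prop⟩
  have uD := uniqueDiffOn_Icc (zero_lt_one' ℝ)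
  have d1 : EqOn (derivWithin F (Icc 0 1)) (fun r => -(r * wavg k q r)) (Icc 0 1) :=
    fun r hr => (hF r).hasDerivWithinAt.derivWithin (uD r hr)
  refine ⟨F, cF.contDiffOn, by simp [F, picard], fun r hr => ?_⟩
  have hr' : r ∈ Icc (0 : ℝ) 1 := ⟨hr.1.le, hr.2⟩
  rw [derivWithin_congr d1 (d1 hr'), d1 hr',
    (hF' r).hasDerivWithinAt.derivWithin (uD r hr')]
  -- The fixed-point identity says that `u` is `F` on `[0,1]`.
  have hqr : q r = μ r * F r := by
    have : F r = u ⟨r, hr'⟩ := congrArg (fun v : C(Icc (0 : ℝ) 1, ℝ) => v ⟨r, hr'⟩) hu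
    simp only [q, clampExt_eq μ hr', this, IccExtend_of_mem (zero_le_one' ℝ) u hr']
  rw [hqr]
  have := hr.1.ne'
  field_simp
  ring

end

/-! ### Regularity of the profile and the radial equation in divergence form. -/

section

/-- `f₀'(r) = r D(r)` on `[0,1]` with `D` continuous and `D ≥ c > 0` on `(0,1]`. -/
structure IsProfileSlope (f₀ D : ℝ → ℝ) (c : ℝ) : Prop where
  pos : 0 < c
  cont : ContinuousOn D (Icc 0 1)
  le : ∀ r ∈ Ioc (0 : ℝ) 1, c ≤ D r
  hasDeriv : ∀ r ∈ Icc (0 : ℝ) 1, HasDerivWithinAt f₀ (r * D r) (Icc 0 1) r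

/-- By the chain rule `D(r) = 2 g'(r²)`; this cancels the factor `1/r` in `μ` and makes it
continuous up to `0`. -/
lemma exists_isProfileSlope {β : ℝ} {f₀ : ℝ → ℝ} (hs : SmoothProfile β f₀)
    (hm : MonotoneProfile f₀) : ∃ D c, IsProfileSlope f₀ D c := by
  obtain ⟨g, hg, hg2, -⟩ := hs
  obtain ⟨c, hc, hcl⟩ := hm
  have uD := uniqueDiffOn_Icc (zero_lt_one' ℝ)
  have hsq : MapsTo (fun r : ℝ => r ^ 2) (Icc 0 1) (Icc 0 1) := fun r hr =>
    ⟨sq_nonneg r, pow_le_one₀ hr.1 hr.2⟩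
  have hd : ∀ r ∈ Icc (0 : ℝ) 1, HasDerivWithinAt f₀
      (r * (2 * derivWithin g (Icc 0 1) (r ^ 2))) (Icc 0 1) r := by
    intro r hr
    have h1 := (hg2.differentiableOn (by norm_num) _ (hsq hr)).hasDerivWithinAt
    have h2 := HasDerivWithinAt.comp (h := fun r : ℝ => r ^ 2) r h1
      ((hasDerivAt_pow 2 r).hasDerivWithinAt (s := Icc 0 1)) hsq
    refine (h2.congr (fun x hx => hg x hx) (hg r hr)).congr_deriv ?_
    push_cast; ring
  refine ⟨fun r => 2 * derivWithin g (Icc 0 1) (r ^ 2), c, hc, ?_, fun r hr => ?_, hd⟩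
  · exact continuousOn_const.mul ((hg2.continuousOn_derivWithin uD (by norm_num)).comp
      (by fun_prop) hsq)
  · have hr' : r ∈ Icc (0 : ℝ) 1 := ⟨hr.1.le, hr.2⟩
    have := hcl r hr
    rwa [profileDeriv, (hd r hr').derivWithin (uD r hr'), mul_div_cancel_left₀ _ hr.1.ne'] at this

variable {f₀ D : ℝ → ℝ} {c Ω : ℝ}

lemma IsProfileSlope.continuousOn (h : IsProfileSlope f₀ D c) : ContinuousOn f₀ (Icc 0 1) :=
  fun r hr => (h.hasDeriv r hr).continuousWithinAt

lemma IsProfileSlope.profileDeriv_eq (h : IsProfileSlope f₀ D c) {r : ℝ}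
    (hr : r ∈ Icc (0 : ℝ) 1) : profileDeriv f₀ r = r * D r :=
  (h.hasDeriv r hr).derivWithin (uniqueDiffOn_Icc (zero_lt_one' ℝ) r hr)

/-- Comparison of increments by comparison of derivatives. -/
lemma sub_le_sub_of_hasDerivAt_le {u v u' v' : ℝ → ℝ} (hu : ContinuousOn u (Icc 0 1))
    (hv : ContinuousOn v (Icc 0 1)) (hu' : ∀ r ∈ Ioo (0 : ℝ) 1, HasDerivAt u (u' r) r)
    (hv' : ∀ r ∈ Ioo (0 : ℝ) 1, HasDerivAt v (v' r) r)
    (hle : ∀ r ∈ Ioo (0 : ℝ) 1, u' r ≤ v' r) {x y : ℝ} (hx : x ∈ Icc (0 : ℝ) 1)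
    (hy : y ∈ Icc (0 : ℝ) 1) (hxy : x ≤ y) : u y - u x ≤ v y - v x := by
  have hm : MonotoneOn (v - u) (Icc 0 1) := by
    apply monotoneOn_of_deriv_nonneg (convex_Icc 0 1) (hv.sub hu) <;> rw [interior_Icc]
    · exact fun r hr => ((hv' r hr).sub (hu' r hr)).differentiableAt.differentiableWithinAt
    · intro r hr
      rw [((hv' r hr).sub (hu' r hr)).deriv]
      linarith [hle r hr]
  have := hm hx hy hxy
  simp only [Pi.sub_apply] at this
  linarith

lemma IsProfileSlope.hasDerivAt (h : IsProfileSlope f₀ D c) {r : ℝ} (hr : r ∈ Ioo (0 : ℝ) 1) :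
    HasDerivAt f₀ (r * D r) r :=
  (h.hasDeriv r ⟨hr.1.le, hr.2.le⟩).hasDerivAt (Icc_mem_nhds hr.1 hr.2)

/-- `f₀` grows at least as fast as `c r² / 2`. -/
lemma IsProfileSlope.le_sub (h : IsProfileSlope f₀ D c) {x y : ℝ} (hx : x ∈ Icc (0 : ℝ) 1)
    (hy : y ∈ Icc (0 : ℝ) 1) (hxy : x ≤ y) : c / 2 * (y ^ 2 - x ^ 2) ≤ f₀ y - f₀ x := by
  have := sub_le_sub_of_hasDerivAt_le (u := fun r => c / 2 * r ^ 2) (by fun_prop) h.continuousOn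
    (fun r _ => (hasDerivAt_pow 2 r).const_mul (c / 2)) (fun r hr => h.hasDerivAt hr)
    (fun r hr => by
      have := mul_le_mul_of_nonneg_left (h.le r ⟨hr.1, hr.2.le⟩) hr.1.le
      norm_num
      linarith) hx hy hxy
  linarith

/-- `f₀` grows at most as fast as `M r² / 2`. -/
lemma IsProfileSlope.sub_le (h : IsProfileSlope f₀ D c) {M : ℝ}
    (hM : ∀ r ∈ Icc (0 : ℝ) 1, |D r| ≤ M) {x y : ℝ} (hx : x ∈ Icc (0 : ℝ) 1)
    (hy : y ∈ Icc (0 : ℝ) 1) (hxy : x ≤ y) : f₀ y - f₀ x ≤ M / 2 * (y ^ 2 - x ^ 2) := by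
  have := sub_le_sub_of_hasDerivAt_le (v := fun r => M / 2 * r ^ 2) h.continuousOn (by fun_prop)
    (fun r hr => h.hasDerivAt hr) (fun r _ => (hasDerivAt_pow 2 r).const_mul (M / 2))
    (fun r hr => by
      have := mul_le_mul_of_nonneg_left
        ((le_abs_self _).trans (hM r ⟨hr.1.le, hr.2.le⟩)) hr.1.le
      norm_num
      linarith) hx hy hxy
  linarith

lemma IsProfileSlope.mono (h : IsProfileSlope f₀ D c) : MonotoneOn f₀ (Icc 0 1) := by
  intro x hx y hy hxy
  have := h.le_sub hx hy hxy
  have h2 : x ^ 2 ≤ y ^ 2 := pow_le_pow_left₀ hx.1 hxy 2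
  nlinarith [h.pos]

lemma integral_mul_comp_mul (f : ℝ → ℝ) (r : ℝ) :
    ∫ s in (0 : ℝ)..1, s * f (s * r) = wavg 1 f r := by
  simp [wavg]

lemma wavg_one_one (f : ℝ → ℝ) : wavg 1 f 1 = kappa₂ f := by
  simp [wavg, kappa₂]

lemma wavg_at_one (k : ℕ) (f : ℝ → ℝ) : wavg k f 1 = ∫ s in (0 : ℝ)..1, s ^ k * f s := by
  simp [wavg]

/-- The continuous representative of `μ_Ω⁰` on `[0,1]`. -/
def coef (f₀ D : ℝ → ℝ) (Ω r : ℝ) : ℝ := D r / (Ω - wavg 1 f₀ r)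

lemma IsProfileSlope.mu_eq (h : IsProfileSlope f₀ D c) {r : ℝ} (hr : r ∈ Ioc (0 : ℝ) 1) :
    mu f₀ Ω r = coef f₀ D Ω r := by
  rw [mu, coef, h.profileDeriv_eq ⟨hr.1.le, hr.2⟩, integral_mul_comp_mul,
    mul_div_mul_left _ _ hr.1.ne']

lemma IsProfileSlope.continuousOn_coef (h : IsProfileSlope f₀ D c)
    (hΩ : ∀ r ∈ Icc (0 : ℝ) 1, Ω - wavg 1 f₀ r ≠ 0) : ContinuousOn (coef f₀ D Ω) (Icc 0 1) :=
  h.cont.div (continuousOn_const.sub (continuousOn_wavg 1 h.continuousOn)) hΩ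

/-- `F` solves `(r^k F')' = -r^k μ F` on `(0,1)`, with `F` and `F'` continuous on `[0,1]`. -/
structure IsRadialSolution (k : ℕ) (μ F F' : ℝ → ℝ) : Prop where
  cont : ContinuousOn F (Icc 0 1)
  cont' : ContinuousOn F' (Icc 0 1)
  zero : F 0 = 1
  hasDeriv : ∀ r ∈ Ioo (0 : ℝ) 1, HasDerivAt F (F' r) r
  hasDeriv' : ∀ r ∈ Ioo (0 : ℝ) 1,
    HasDerivAt (fun r => r ^ k * F' r) (-(r ^ k * (μ r * F r))) r

/-- A solution exists, so `sturm` does not take its default value `0`; multiplying its equation by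
`r^{2n+1}` gives the divergence form. -/
lemma IsProfileSlope.isRadialSolution_sturm (h : IsProfileSlope f₀ D c)
    (hΩ : ∀ r ∈ Icc (0 : ℝ) 1, Ω - wavg 1 f₀ r ≠ 0) (n : ℕ) :
    IsRadialSolution (2 * n + 1) (coef f₀ D Ω) (sturm f₀ n Ω)
      (derivWithin (sturm f₀ n Ω) (Icc 0 1)) := by
  have hex : ∃ F, IsSturmSolution f₀ n Ω F := by
    obtain ⟨F, h1, h2, h3⟩ := exists_radial_solution (2 * n + 1) (h.continuousOn_coef hΩ)
    refine ⟨F, h1, h2, fun r hr => ?_⟩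
    rw [h.mu_eq hr]
    exact_mod_cast h3 r hr
  have hS : IsSturmSolution f₀ n Ω (sturm f₀ n Ω) := by
    rw [sturm, dif_pos hex]; exact hex.choose_spec
  set F := sturm f₀ n Ω
  obtain ⟨h1, h2, h3⟩ := hS
  have uD := uniqueDiffOn_Icc (zero_lt_one' ℝ)
  have h1' : ContDiffOn ℝ 1 (derivWithin F (Icc 0 1)) (Icc 0 1) :=
    h1.derivWithin uD (by norm_num)
  refine ⟨h1.continuousOn, h1'.continuousOn, h2, fun r hr => ?_, fun r hr => ?_⟩
  · exact (h1.differentiableOn (by norm_num) r ⟨hr.1.le, hr.2.le⟩).hasDerivWithinAt.hasDerivAt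
      (Icc_mem_nhds hr.1 hr.2)
  · have hd := (h1'.differentiableOn (by norm_num) r
      ⟨hr.1.le, hr.2.le⟩).hasDerivWithinAt.hasDerivAt (Icc_mem_nhds hr.1 hr.2)
    refine ((hasDerivAt_pow (2 * n + 1) r).mul hd).congr_deriv ?_
    have e := h3 r ⟨hr.1, hr.2.le⟩
    rw [h.mu_eq ⟨hr.1, hr.2.le⟩] at e
    have hr0 := hr.1.ne'
    simp only [Nat.add_sub_cancel]
    have e2 : derivWithin (derivWithin F (Icc 0 1)) (Icc 0 1) r =
      - ((2 * (n : ℝ) + 1) / r * derivWithin F (Icc 0 1) r) - coef f₀ D Ω r * F r := by linarith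
    rw [e2]
    push_cast
    field_simp
    ring

/-! ### Variation of constants. -/

variable {k : ℕ} {μ F F' b : ℝ → ℝ}

lemma continuousOn_pow_mul (k : ℕ) {q : ℝ → ℝ} {s : Set ℝ} (hq : ContinuousOn q s) :
    ContinuousOn (fun r => r ^ k * q r) s :=
  (by fun_prop : Continuous fun r : ℝ => r ^ k).continuousOn.mul hq

lemma intervalIntegrable_of_continuousOn {q : ℝ → ℝ} (hq : ContinuousOn q (Icc 0 1)) {x y : ℝ}
    (hx : x ∈ Icc (0 : ℝ) 1) (hy : y ∈ Icc (0 : ℝ) 1) :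
    IntervalIntegrable q MeasureTheory.volume x y :=
  (hq.mono (uIcc_subset_Icc hx hy)).intervalIntegrable

lemma continuousOn_primitive {q : ℝ → ℝ} (hq : ContinuousOn q (Icc 0 1)) {x : ℝ}
    (hx : x ∈ Icc (0 : ℝ) 1) : ContinuousOn (fun r => ∫ s in x..r, q s) (Icc 0 1) := by
  have := intervalIntegral.continuousOn_primitive_interval'
    (intervalIntegrable_of_continuousOn hq ⟨le_rfl, zero_le_one⟩ ⟨zero_le_one, le_rfl⟩)
    (by rwa [uIcc_of_le zero_le_one])
  rwa [uIcc_of_le zero_le_one] at this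

lemma hasDerivAt_primitive {q : ℝ → ℝ} (hq : ContinuousOn q (Icc 0 1)) {x r : ℝ}
    (hx : x ∈ Icc (0 : ℝ) 1) (hr : r ∈ Ioo (0 : ℝ) 1) :
    HasDerivAt (fun r => ∫ s in x..r, q s) (q r) r :=
  intervalIntegral.integral_hasDerivAt_right
    (intervalIntegrable_of_continuousOn hq hx ⟨hr.1.le, hr.2.le⟩)
    ((hq.mono Ioo_subset_Icc_self).stronglyMeasurableAtFilter isOpen_Ioo r hr)
    (hq.continuousAt (Icc_mem_nhds hr.1 hr.2))

/-- The flux identity `r^k F' = -∫₀^r s^k μ F`. -/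
lemma IsRadialSolution.flux (hF : IsRadialSolution k μ F F') (hk : k ≠ 0)
    (hμ : ContinuousOn μ (Icc 0 1)) {r : ℝ} (hr : r ∈ Icc (0 : ℝ) 1) :
    r ^ k * F' r = -∫ s in (0 : ℝ)..r, s ^ k * (μ s * F s) := by
  have hsub : Icc 0 r ⊆ Icc (0 : ℝ) 1 := Icc_subset_Icc_right hr.2
  have h := intervalIntegral.integral_eq_sub_of_hasDerivAt_of_le (a := 0) (b := r) hr.1
    (f := fun r => r ^ k * F' r) (f' := fun r => -(r ^ k * (μ r * F r)))
    (continuousOn_pow_mul k (hF.cont'.mono hsub))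
    (fun x hx => hF.hasDeriv' x ⟨hx.1, hx.2.trans_le hr.2⟩)
    (intervalIntegrable_of_continuousOn (continuousOn_pow_mul k (hμ.mul hF.cont)).neg
      ⟨le_rfl, zero_le_one⟩ hr)
  simp only [zero_pow hk, zero_mul, sub_zero, intervalIntegral.integral_neg] at h
  exact h.symm

/-- The function `Φ` for which `FΦ` solves the radial equation with right-hand side `b`
and `F(1)Φ(1) = 0`. -/
def varConst (k : ℕ) (F b : ℝ → ℝ) (r : ℝ) : ℝ :=
  ∫ s in (1 : ℝ)..r, 1 / (F s ^ 2 * s ^ k) * ∫ τ in (0 : ℝ)..s, F τ * τ ^ k * b τ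

/-- The apparent singularity at `s = 0` is removable; both sides vanish there, division by zero
included. -/
lemma varConst_integrand (k : ℕ) (F b : ℝ → ℝ) (s : ℝ) :
    1 / (F s ^ 2 * s ^ k) * ∫ τ in (0 : ℝ)..s, F τ * τ ^ k * b τ
      = s * wavg k (fun x => F x * b x) s / F s ^ 2 := by
  have e : ∫ τ in (0 : ℝ)..s, F τ * τ ^ k * b τ = ∫ τ in (0 : ℝ)..s, τ ^ k * (F τ * b τ) := by
    congr 1; ext τ; ring
  rw [e, ← inv_pow_mul_integral]
  rw [one_div, mul_inv]
  ring

lemma varConst_eq (k : ℕ) (F b : ℝ → ℝ) (r : ℝ) :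
    varConst k F b r = ∫ s in (1 : ℝ)..r, s * wavg k (fun x => F x * b x) s / F s ^ 2 := by
  simp only [varConst, varConst_integrand]

lemma continuousOn_varConst_integrand (k : ℕ) (hF : ContinuousOn F (Icc 0 1))
    (hb : ContinuousOn b (Icc 0 1)) (h0 : ∀ r ∈ Icc (0 : ℝ) 1, F r ≠ 0) :
    ContinuousOn (fun s => s * wavg k (fun x => F x * b x) s / F s ^ 2) (Icc 0 1) :=
  (continuousOn_id.mul (continuousOn_wavg k (hF.mul hb))).div (hF.pow 2)
    fun r hr => pow_ne_zero 2 (h0 r hr)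

lemma continuousOn_varConst (k : ℕ) (hF : ContinuousOn F (Icc 0 1))
    (hb : ContinuousOn b (Icc 0 1)) (h0 : ∀ r ∈ Icc (0 : ℝ) 1, F r ≠ 0) :
    ContinuousOn (varConst k F b) (Icc 0 1) :=
  (continuousOn_primitive (continuousOn_varConst_integrand k hF hb h0)
    ⟨zero_le_one, le_rfl⟩).congr fun r _ => varConst_eq k F b r

lemma hasDerivAt_varConst (k : ℕ) (hF : ContinuousOn F (Icc 0 1))
    (hb : ContinuousOn b (Icc 0 1)) (h0 : ∀ r ∈ Icc (0 : ℝ) 1, F r ≠ 0) {r : ℝ}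
    (hr : r ∈ Ioo (0 : ℝ) 1) :
    HasDerivAt (varConst k F b) (r * wavg k (fun x => F x * b x) r / F r ^ 2) r := by
  rw [show varConst k F b = _ from funext (varConst_eq k F b)]
  exact hasDerivAt_primitive (continuousOn_varConst_integrand k hF hb h0)
    ⟨zero_le_one, le_rfl⟩ hr

/-- Integrating the inhomogeneous radial equation for `FΦ` over `[0,1]`. -/
lemma IsRadialSolution.integral_mul_varConst (hF : IsRadialSolution k μ F F') (hk : k ≠ 0)
    (hμ : ContinuousOn μ (Icc 0 1)) (hb : ContinuousOn b (Icc 0 1))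
    (h0 : ∀ r ∈ Icc (0 : ℝ) 1, F r ≠ 0) :
    ∫ r in (0 : ℝ)..1, r ^ k * (μ r * F r * varConst k F b r)
      = (∫ r in (0 : ℝ)..1, r ^ k * b r)
        - (∫ r in (0 : ℝ)..1, r ^ k * (F r * b r)) / F 1 := by
  have i0 : (0 : ℝ) ∈ Icc (0 : ℝ) 1 := ⟨le_rfl, zero_le_one⟩
  have i1 : (1 : ℝ) ∈ Icc (0 : ℝ) 1 := ⟨zero_le_one, le_rfl⟩
  have cΦ := continuousOn_varConst k hF.cont hb h0
  have cQ : ContinuousOn (fun r => r ^ k * (F r * b r)) (Icc 0 1) :=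
    continuousOn_pow_mul k (hF.cont.mul hb)
  have c1 : ContinuousOn (fun r => r ^ k * (μ r * F r * varConst k F b r)) (Icc 0 1) :=
    continuousOn_pow_mul k ((hμ.mul hF.cont).mul cΦ)
  have c2 := continuousOn_pow_mul k hb
  -- With `Q(r) = ∫₀^r s^k F b`, one has `Φ' = Q / (r^k F²)`, so the function below is the flux `r^k
  -- (FΦ)'`. In its derivative the terms `± Q F'/F²` cancel. Its value is `0` at `r = 0` and
  -- `Q(1)/F(1)` at `r = 1`, where `Φ` vanishes.
  have key := intervalIntegral.integral_eq_sub_of_hasDerivAt_of_le (a := 0) (b := 1) zero_le_one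
    (f := fun r => r ^ k * F' r * varConst k F b r
      + (∫ s in (0 : ℝ)..r, s ^ k * (F s * b s)) / F r)
    (f' := fun r => r ^ k * b r - r ^ k * (μ r * F r * varConst k F b r))
    (((continuousOn_pow_mul k hF.cont').mul cΦ).add
      ((continuousOn_primitive cQ i0).div hF.cont h0))
    (fun r hr => by
      have hr' : r ∈ Icc (0 : ℝ) 1 := ⟨hr.1.le, hr.2.le⟩
      refine (((hF.hasDeriv' r hr).mul (hasDerivAt_varConst k hF.cont hb h0 hr)).add
        ((hasDerivAt_primitive cQ i0 hr).div (hF.hasDeriv r hr) (h0 r hr'))).congr_deriv ?_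
      rw [← pow_succ_mul_wavg k (fun x => F x * b x)]
      have := h0 r hr'
      field_simp
      ring)
    ((intervalIntegrable_of_continuousOn c2 i0 i1).sub
      (intervalIntegrable_of_continuousOn c1 i0 i1))
  rw [intervalIntegral.integral_sub (intervalIntegrable_of_continuousOn c2 i0 i1)
    (intervalIntegrable_of_continuousOn c1 i0 i1)] at key
  have e1 : varConst k F b 1 = 0 := by simp [varConst]
  simp only [e1, mul_zero, zero_add, zero_pow hk, zero_mul, intervalIntegral.integral_same,
    zero_div, sub_zero] at key
  linarith

end

/-! ### Reduction of the transversality integral at a zero of the dispersion function. -/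

section

variable {f₀ D : ℝ → ℝ} {c Ω : ℝ} {m : ℕ}

lemma Gfun_one (hm : 1 ≤ m) : Gfun f₀ m Ω 1 = m * (Ω - singularValue f₀ m) := by
  have : (m : ℝ) ≠ 0 := by positivity
  simp only [Gfun, singularValue, one_pow]
  rw [show ∫ s in (0 : ℝ)..1, s * f₀ s = kappa₂ f₀ from rfl]
  field_simp
  ring

/-- The function `N` with `r G_m(r) - r^{m+2} G_m(1) = r^m N(r)`. -/
def gDefect (f₀ : ℝ → ℝ) (m : ℕ) (r : ℝ) : ℝ :=
  kappa₂ f₀ * (1 - r ^ 2) + (m + 1) * r ^ 2 *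
    ((wavg 1 f₀ 1 - wavg 1 f₀ r) - (wavg (2 * m + 1) f₀ 1 - wavg (2 * m + 1) f₀ r))

/-- The two terms `mΩ r^{m+2}` cancel, so the remainder does not depend on `Ω`. -/
lemma mul_Gfun_sub (hm : 1 ≤ m) {r : ℝ} (hr : r ≠ 0) :
    r * Gfun f₀ m Ω r - r ^ (m + 2) * Gfun f₀ m Ω 1 = r ^ m * gDefect f₀ m r := by
  obtain ⟨n, rfl⟩ : ∃ n, m = n + 1 := ⟨m - 1, by omega⟩
  have e1 : ∀ x, ∫ s in (0 : ℝ)..x, s * f₀ s = x ^ 2 * wavg 1 f₀ x := fun x => by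
    simpa using (pow_succ_mul_wavg 1 f₀ x).symm
  have e2 : ∀ x, ∫ s in (0 : ℝ)..x, s ^ (2 * (n + 1) + 1) * f₀ s
      = x ^ (2 * (n + 1) + 2) * wavg (2 * (n + 1) + 1) f₀ x := fun x =>
    (pow_succ_mul_wavg _ f₀ x).symm
  simp only [Gfun, gDefect, e1, e2, ← wavg_one_one, Nat.add_sub_cancel, one_pow]
  field_simp
  ring

lemma Hop_one (h : ℝ → ℝ) : Hop m h 1 = ∫ s in (0 : ℝ)..1, s ^ (m + 1) * h s := by
  simp [Hop]

lemma hStar_eq (r : ℝ) : hStar f₀ m Ω r = r ^ m * sturm f₀ m Ω r * mu f₀ Ω r *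
    varConst (2 * m + 1) (sturm f₀ m Ω) (fun τ => Ω - f₀ τ / 2) r := rfl

lemma integral_congr_Ioc {u v : ℝ → ℝ} (h : EqOn u v (Ioc 0 1)) :
    ∫ r in (0 : ℝ)..1, u r = ∫ r in (0 : ℝ)..1, v r := by
  apply intervalIntegral.integral_congr_ae
  refine Filter.Eventually.of_forall fun r hr => ?_
  rw [uIoc_of_le zero_le_one] at hr
  exact h hr

/-- At a zero of the dispersion function the constant `A_m[h_m^⋆]` is explicit. -/
lemma IsProfileSlope.Aop_hStar (h : IsProfileSlope f₀ D c) (hm : 1 ≤ m)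
    (hΩ : ∀ r ∈ Icc (0 : ℝ) 1, Ω - wavg 1 f₀ r ≠ 0)
    (h0 : ∀ r ∈ Icc (0 : ℝ) 1, sturm f₀ m Ω r ≠ 0) (hζ : zeta f₀ m Ω = 0)
    (hG : Gfun f₀ m Ω 1 ≠ 0) : Aop f₀ m Ω (hStar f₀ m Ω) = 1 / (4 * (m + 1)) := by
  have hF := h.isRadialSolution_sturm hΩ m
  have i0 : (0 : ℝ) ∈ Icc (0 : ℝ) 1 := ⟨le_rfl, zero_le_one⟩
  have i1 : (1 : ℝ) ∈ Icc (0 : ℝ) 1 := ⟨zero_le_one, le_rfl⟩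
  have hb : ContinuousOn (fun τ => Ω - f₀ τ / 2) (Icc 0 1) :=
    continuousOn_const.sub (h.continuousOn.div_const 2)
  have key := hF.integral_mul_varConst (by omega) (h.continuousOn_coef hΩ) hb h0
  have hF1 := h0 1 i1
  set F := sturm f₀ m Ω
  have e1 : Hop m (hStar f₀ m Ω) 1 = ∫ r in (0 : ℝ)..1, r ^ (2 * m + 1) *
      (coef f₀ D Ω r * F r * varConst (2 * m + 1) F (fun τ => Ω - f₀ τ / 2) r) := by
    rw [Hop_one]
    refine integral_congr_Ioc fun r hr => ?_
    simp only [hStar_eq, h.mu_eq hr]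
    ring
  have e2 : ∫ r in (0 : ℝ)..1, r ^ (2 * m + 1) * (Ω - f₀ r / 2)
      = Ω / (2 * m + 2) - (∫ r in (0 : ℝ)..1, r ^ (2 * m + 1) * f₀ r) / 2 := by
    have : ∀ r : ℝ, r ^ (2 * m + 1) * (Ω - f₀ r / 2)
        = Ω * r ^ (2 * m + 1) - 1 / 2 * (r ^ (2 * m + 1) * f₀ r) := fun r => by ring
    simp only [this]
    rw [intervalIntegral.integral_sub
      ((by fun_prop : Continuous fun r : ℝ => Ω * r ^ (2 * m + 1)).intervalIntegrable _ _)
      ((intervalIntegrable_of_continuousOn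
        (continuousOn_pow_mul _ h.continuousOn) i0 i1).const_mul _),
      intervalIntegral.integral_const_mul, intervalIntegral.integral_const_mul, integral_pow]
    push_cast
    simp only [one_pow, ne_eq, Nat.add_eq_zero_iff, one_ne_zero, and_false, not_false_eq_true,
      zero_pow]
    ring
  have e3 : ∫ r in (0 : ℝ)..1, F r * r ^ (2 * m + 1) * (f₀ r - 2 * Ω)
      = -2 * ∫ r in (0 : ℝ)..1, r ^ (2 * m + 1) * (F r * (Ω - f₀ r / 2)) := by
    rw [← intervalIntegral.integral_const_mul]
    congr 1; ext r; ring
  -- The only place where `ζ_m(Ω) = 0` enters.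
  have e4 : (∫ r in (0 : ℝ)..1, r ^ (2 * m + 1) * (F r * (Ω - f₀ r / 2))) / F 1
      = (Ω - m / (m + 1) * kappa₂ f₀) / 2 := by
    rw [zeta, e3] at hζ
    rw [div_eq_iff hF1]
    linarith
  have hm0 : (m : ℝ) ≠ 0 := by positivity
  have e5 : Hop m (hStar f₀ m Ω) 1 = -(Gfun f₀ m Ω 1 / (2 * (m + 1))) := by
    rw [e1, key, e2, e4, Gfun_one hm, singularValue]
    field_simp
    ring
  rw [Aop, e5]
  field_simp
  norm_num

/-- The bracket in the integrand of `𝕀_m`, after `A_m[h_m^⋆]` has been computed. -/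
def bracket (f₀ : ℝ → ℝ) (m : ℕ) (Ω r : ℝ) : ℝ :=
  sturm f₀ m Ω r * varConst (2 * m + 1) (sturm f₀ m Ω) (fun τ => Ω - f₀ τ / 2) r
      / (Ω - wavg 1 f₀ r)
    + 1 / (4 * (m + 1)) * (gDefect f₀ m r / Gfun f₀ m Ω 1)

/-- In `d_m^⋆` the factor `r / f₀'(r)` turns `μ` into `1/(Ω - w)`, where `w` is `wavg 1 f₀`, and the
two remaining terms combine into `r^m N / G_m(1)`. -/
lemma IsProfileSlope.transInt_eq (h : IsProfileSlope f₀ D c) (hm : 1 ≤ m)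
    (hΩ : ∀ r ∈ Icc (0 : ℝ) 1, Ω - wavg 1 f₀ r ≠ 0)
    (h0 : ∀ r ∈ Icc (0 : ℝ) 1, sturm f₀ m Ω r ≠ 0) (hζ : zeta f₀ m Ω = 0)
    (hG : Gfun f₀ m Ω 1 ≠ 0) :
    transInt f₀ m Ω = ∫ r in (0 : ℝ)..1, |coef f₀ D Ω r| *
      (r ^ (2 * m + 1) * (sturm f₀ m Ω r * bracket f₀ m Ω r)) := by
  refine integral_congr_Ioc fun r hr => ?_
  have hr0 := hr.1.ne'
  have hr' : r ∈ Icc (0 : ℝ) 1 := ⟨hr.1.le, hr.2⟩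
  have hD : D r ≠ 0 := (h.pos.trans_le (h.le r hr)).ne'
  have hw := hΩ r hr'
  have e : dStar f₀ m Ω r = r ^ m * bracket f₀ m Ω r := by
    have hg := mul_Gfun_sub (f₀ := f₀) (Ω := Ω) hm hr0
    have hg2 : gDefect f₀ m r = (r * Gfun f₀ m Ω r - r ^ (m + 2) * Gfun f₀ m Ω 1) / r ^ m := by
      rw [hg]; field_simp
    rw [dStar, bracket, h.Aop_hStar hm hΩ h0 hζ hG, hStar_eq, h.mu_eq hr, h.profileDeriv_eq hr',
      coef, hg2]
    field_simp
    ring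
  simp only [nu, h.mu_eq hr, e]
  ring

lemma IsProfileSlope.continuousOn_gDefect (h : IsProfileSlope f₀ D c) (m : ℕ) :
    ContinuousOn (gDefect f₀ m) (Icc 0 1) := by
  have h1 := continuousOn_wavg 1 h.continuousOn
  have h2 := continuousOn_wavg (2 * m + 1) h.continuousOn
  unfold gDefect
  fun_prop

lemma IsProfileSlope.continuousOn_bracket (h : IsProfileSlope f₀ D c)
    (hΩ : ∀ r ∈ Icc (0 : ℝ) 1, Ω - wavg 1 f₀ r ≠ 0)
    (h0 : ∀ r ∈ Icc (0 : ℝ) 1, sturm f₀ m Ω r ≠ 0) :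
    ContinuousOn (bracket f₀ m Ω) (Icc 0 1) := by
  have hF := h.isRadialSolution_sturm hΩ m
  have hb : ContinuousOn (fun τ => Ω - f₀ τ / 2) (Icc 0 1) :=
    continuousOn_const.sub (h.continuousOn.div_const 2)
  have hΦ := continuousOn_varConst (2 * m + 1) hF.cont hb h0
  exact ((hF.cont.mul hΦ).div
    (continuousOn_const.sub (continuousOn_wavg 1 h.continuousOn)) hΩ).add
    (continuousOn_const.mul ((h.continuousOn_gDefect m).div_const _))

lemma IsProfileSlope.continuousOn_integrand (h : IsProfileSlope f₀ D c)
    (hΩ : ∀ r ∈ Icc (0 : ℝ) 1, Ω - wavg 1 f₀ r ≠ 0)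
    (h0 : ∀ r ∈ Icc (0 : ℝ) 1, sturm f₀ m Ω r ≠ 0) :
    ContinuousOn (fun r => |coef f₀ D Ω r| *
      (r ^ (2 * m + 1) * (sturm f₀ m Ω r * bracket f₀ m Ω r))) (Icc 0 1) :=
  (h.continuousOn_coef hΩ).abs.mul (continuousOn_pow_mul _
    ((h.isRadialSolution_sturm hΩ m).cont.mul (h.continuousOn_bracket hΩ h0)))

/-! ### Bounds for averages of the profile and for `N`. -/

lemma IsProfileSlope.wavg_sub_eq (h : IsProfileSlope f₀ D c) (k : ℕ) {r : ℝ}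
    (hr : r ∈ Icc (0 : ℝ) 1) :
    wavg k f₀ 1 - wavg k f₀ r = ∫ t in (0 : ℝ)..1, t ^ k * (f₀ t - f₀ (t * r)) := by
  have i1 : (1 : ℝ) ∈ Icc (0 : ℝ) 1 := ⟨zero_le_one, le_rfl⟩
  rw [wavg, wavg, ← intervalIntegral.integral_sub (intervalIntegrable_wavg k h.continuousOn i1)
    (intervalIntegrable_wavg k h.continuousOn hr)]
  congr 1; ext t; simp; ring

/-- The growth of `f₀` bounds the increments of its weighted averages from below. -/
lemma IsProfileSlope.le_wavg_sub_sub (h : IsProfileSlope f₀ D c) (m : ℕ) {r : ℝ}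
    (hr : r ∈ Icc (0 : ℝ) 1) :
    c / 2 * (1 - r ^ 2) * (1 / 4 - 1 / (2 * m + 4)) ≤
      (wavg 1 f₀ 1 - wavg 1 f₀ r) - (wavg (2 * m + 1) f₀ 1 - wavg (2 * m + 1) f₀ r) := by
  have i0 : (0 : ℝ) ∈ Icc (0 : ℝ) 1 := ⟨le_rfl, zero_le_one⟩
  have i1 : (1 : ℝ) ∈ Icc (0 : ℝ) 1 := ⟨zero_le_one, le_rfl⟩
  have hc : ContinuousOn (fun t => f₀ t - f₀ (t * r)) (Icc 0 1) :=
    h.continuousOn.sub (h.continuousOn.comp (by fun_prop) fun t ht => mul_mem_Icc ht hr)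
  have ii : ∀ k : ℕ, IntervalIntegrable (fun t => t ^ k * (f₀ t - f₀ (t * r)))
      MeasureTheory.volume 0 1 := fun k =>
    intervalIntegrable_of_continuousOn (continuousOn_pow_mul k hc) i0 i1
  rw [h.wavg_sub_eq 1 hr, h.wavg_sub_eq (2 * m + 1) hr,
    ← intervalIntegral.integral_sub (ii 1) (ii (2 * m + 1))]
  have e : c / 2 * (1 - r ^ 2) * (1 / 4 - 1 / (2 * m + 4)) =
      ∫ t in (0 : ℝ)..1, c / 2 * (1 - r ^ 2) * (t ^ 3 - t ^ (2 * m + 3)) := by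
    rw [intervalIntegral.integral_const_mul, intervalIntegral.integral_sub
      ((by fun_prop : Continuous fun t : ℝ => t ^ 3).intervalIntegrable _ _)
      ((by fun_prop : Continuous fun t : ℝ => t ^ (2 * m + 3)).intervalIntegrable _ _),
      integral_pow, integral_pow]
    push_cast
    norm_num
    left
    ring_nf
  rw [e]
  apply intervalIntegral.integral_mono_on zero_le_one
  · exact (by fun_prop : Continuous fun t : ℝ =>
      c / 2 * (1 - r ^ 2) * (t ^ 3 - t ^ (2 * m + 3))).intervalIntegrable _ _
  · exact (ii 1).sub (ii (2 * m + 1))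
  · intro t ht
    have h1 := h.le_sub (mul_mem_Icc ht hr) ht (mul_le_of_le_one_right ht.1 hr.2)
    have h2 : t ^ (2 * m + 1) ≤ t ^ 1 := pow_le_pow_of_le_one ht.1 ht.2 (by omega)
    calc c / 2 * (1 - r ^ 2) * (t ^ 3 - t ^ (2 * m + 3))
        = (t ^ 1 - t ^ (2 * m + 1)) * (c / 2 * (t ^ 2 - (t * r) ^ 2)) := by ring
      _ ≤ (t ^ 1 - t ^ (2 * m + 1)) * (f₀ t - f₀ (t * r)) :=
        mul_le_mul_of_nonneg_left h1 (by linarith)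
      _ = _ := by ring

/-- For `κ₂ > 0` the first term alone suffices; for `κ₂ < 0` the second, of order `m`, dominates
near `r = 1`. -/
lemma IsProfileSlope.le_gDefect (h : IsProfileSlope f₀ D c) (m : ℕ) {r : ℝ}
    (hr : r ∈ Icc (0 : ℝ) 1) :
    (1 - r ^ 2) * (kappa₂ f₀ + (m + 1) * r ^ 2 * (c / 2 * (1 / 4 - 1 / (2 * m + 4))))
      ≤ gDefect f₀ m r := by
  have := mul_le_mul_of_nonneg_left (h.le_wavg_sub_sub m hr)
    (by positivity : (0 : ℝ) ≤ (m + 1) * r ^ 2)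
  rw [gDefect]
  linarith

lemma IsProfileSlope.wavg_le (h : IsProfileSlope f₀ D c) (k : ℕ) {r : ℝ}
    (hr : r ∈ Icc (0 : ℝ) 1) : wavg k f₀ r ≤ f₀ r / (k + 1) := by
  rw [← integral_pow_mul_const]
  apply intervalIntegral.integral_mono_on zero_le_one (intervalIntegrable_wavg k h.continuousOn hr)
    ((by fun_prop : Continuous fun t : ℝ => t ^ k * f₀ r).intervalIntegrable _ _)
  intro t ht
  exact mul_le_mul_of_nonneg_left (h.mono (mul_mem_Icc ht hr) hr
    (mul_le_of_le_one_left hr.1 ht.2)) (pow_nonneg ht.1 k)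

lemma IsProfileSlope.le_wavg (h : IsProfileSlope f₀ D c) (k : ℕ) {r : ℝ}
    (hr : r ∈ Icc (0 : ℝ) 1) : f₀ 0 / (k + 1) ≤ wavg k f₀ r := by
  rw [← integral_pow_mul_const]
  apply intervalIntegral.integral_mono_on zero_le_one
    ((by fun_prop : Continuous fun t : ℝ => t ^ k * f₀ 0).intervalIntegrable _ _)
    (intervalIntegrable_wavg k h.continuousOn hr)
  intro t ht
  exact mul_le_mul_of_nonneg_left (h.mono ⟨le_rfl, zero_le_one⟩ (mul_mem_Icc ht hr)
    (mul_nonneg ht.1 hr.1)) (pow_nonneg ht.1 k)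

end

/-! ### Positive profiles. -/

section

variable {f₀ D : ℝ → ℝ} {c Ω : ℝ} {m k : ℕ} {μ F F' b : ℝ → ℝ}

/-- For `μ ≤ 0` the normalized radial solution is at least `1` and nondecreasing. -/
lemma IsRadialSolution.one_le_and_monotoneOn (hF : IsRadialSolution k μ F F') (hk : k ≠ 0)
    (hμ : ∀ r ∈ Ioo (0 : ℝ) 1, μ r ≤ 0) :
    (∀ r ∈ Icc (0 : ℝ) 1, 1 ≤ F r) ∧ MonotoneOn F (Icc 0 1) := by
  have i0 : (0 : ℝ) ∈ Icc (0 : ℝ) 1 := ⟨le_rfl, zero_le_one⟩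
  -- The derivative of `r^k F' F` is `r^k (F'² - μF²) ≥ 0`. This makes `F²` nondecreasing without
  -- knowing the sign of `F`, which then cannot vanish.
  have hE : ∀ r ∈ Ioo (0 : ℝ) 1, 0 ≤ r ^ k * F' r * F r := by
    intro r hr
    have := sub_le_sub_of_hasDerivAt_le (u := fun _ => (0 : ℝ)) (u' := fun _ => 0)
      (v := fun r => r ^ k * F' r * F r) continuousOn_const
      ((continuousOn_pow_mul k hF.cont').mul hF.cont) (fun r _ => hasDerivAt_const r 0)
      (fun r hr => (hF.hasDeriv' r hr).mul (hF.hasDeriv r hr)) (fun r hr => by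
        have h1 : 0 ≤ r ^ k * F' r ^ 2 := mul_nonneg (pow_nonneg hr.1.le k) (sq_nonneg _)
        have h2 : 0 ≤ r ^ k * (-μ r * F r ^ 2) := mul_nonneg (pow_nonneg hr.1.le k)
          (mul_nonneg (neg_nonneg.2 (hμ r hr)) (sq_nonneg _))
        linarith) i0 ⟨hr.1.le, hr.2.le⟩ hr.1.le
    simpa [zero_pow hk] using this
  have hsq : ∀ x ∈ Icc (0 : ℝ) 1, ∀ y ∈ Icc (0 : ℝ) 1, x ≤ y → F x ^ 2 ≤ F y ^ 2 := by
    intro x hx y hy hxy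
    have := sub_le_sub_of_hasDerivAt_le (u := fun _ => (0 : ℝ)) (u' := fun _ => 0)
      (v := fun r => F r ^ 2) continuousOn_const
      (hF.cont.pow 2) (fun r _ => hasDerivAt_const r 0)
      (fun r hr => (hF.hasDeriv r hr).pow 2) (fun r hr => by
        have h1 := hE r hr
        have h2 : 0 ≤ F' r * F r := by
          rw [mul_assoc] at h1
          exact nonneg_of_mul_nonneg_right h1 (pow_pos hr.1 k)
        norm_num
        linarith) hx hy hxy
    linarith
  have hone : ∀ r ∈ Icc (0 : ℝ) 1, 1 ≤ F r ^ 2 := fun r hr => by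
    simpa [hF.zero] using hsq 0 i0 r hr hr.1
  have hpos : ∀ r ∈ Icc (0 : ℝ) 1, 0 < F r := by
    intro r hr
    by_contra hneg
    obtain ⟨x, hx, hx0⟩ := intermediate_value_Icc' hr.1
      (hF.cont.mono (Icc_subset_Icc_right hr.2))
      (show (0 : ℝ) ∈ Icc (F r) (F 0) from ⟨not_lt.1 hneg, by rw [hF.zero]; exact zero_le_one⟩)
    have := hone x ⟨hx.1, hx.2.trans hr.2⟩
    rw [hx0] at this
    norm_num at this
  exact ⟨fun r hr => (one_le_sq_iff₀ (hpos r hr).le).1 (hone r hr), fun x hx y hy hxy =>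
    (pow_le_pow_iff_left₀ (hpos x hx).le (hpos y hy).le two_ne_zero).1 (hsq x hx y hy hxy)⟩

/-- A bound of `Φ` by means of bounds of the integrand that defines it. -/
lemma abs_varConst_le (k : ℕ) {r C : ℝ} (hr : r ∈ Icc (0 : ℝ) 1)
    (hC : ∀ s ∈ Icc r 1, |wavg k (fun x => F x * b x) s| / F s ^ 2 ≤ C) :
    |varConst k F b r| ≤ C / 2 * (1 - r ^ 2) := by
  have e : ∫ s in r..1, C * s = C / 2 * (1 - r ^ 2) := by
    rw [intervalIntegral.integral_const_mul, integral_id]; ring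
  rw [varConst_eq, intervalIntegral.integral_symm, abs_neg, ← e, ← Real.norm_eq_abs]
  apply intervalIntegral.norm_integral_le_of_norm_le hr.2
  · refine Filter.Eventually.of_forall fun s hs => ?_
    have hs0 : 0 ≤ s := hr.1.trans hs.1.le
    rw [Real.norm_eq_abs, abs_div, abs_mul, abs_of_nonneg hs0, abs_of_nonneg (sq_nonneg (F s)),
      mul_div_assoc, mul_comm]
    exact mul_le_mul_of_nonneg_right (hC s ⟨hs.1.le, hs.2⟩) hs0
  · exact (by fun_prop : Continuous fun s : ℝ => C * s).intervalIntegrable _ _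

/-- The transversality integral is positive for positive profiles. -/
theorem IsProfileSlope.transInt_pos (h : IsProfileSlope f₀ D c) (hf : 0 < f₀ 0) (hm : 3 ≤ m)
    (hmf : (m : ℝ) ≤ 1 / 10 * (f₀ 0 / (f₀ 1 - f₀ 0)))
    (hΩ : Ω ∈ Ioo (singularValue f₀ m) (m * kappa₂ f₀ / (m + 1))) (hζ : zeta f₀ m Ω = 0) :
    0 < transInt f₀ m Ω := by
  have i0 : (0 : ℝ) ∈ Icc (0 : ℝ) 1 := ⟨le_rfl, zero_le_one⟩
  have i1 : (1 : ℝ) ∈ Icc (0 : ℝ) 1 := ⟨zero_le_one, le_rfl⟩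
  have hm3 : (3 : ℝ) ≤ m := by exact_mod_cast hm
  have hd : 0 < f₀ 1 - f₀ 0 := by have := h.le_sub i0 i1 zero_le_one; linarith [h.pos]
  set d := f₀ 1 - f₀ 0 with hd_def
  have hmd : 10 * (m * d) ≤ f₀ 0 := by
    have : 10 * (m : ℝ) ≤ f₀ 0 / d := by linarith
    rw [le_div_iff₀ hd] at this
    linarith
  have hmd' : (m + 1) * d ≤ 4 / 30 * f₀ 0 := by nlinarith
  have hκ1 : f₀ 0 / 2 ≤ kappa₂ f₀ := by
    have := h.le_wavg 1 i1
    rw [wavg_one_one] at this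
    norm_num at this
    exact this
  have hκ2 : kappa₂ f₀ ≤ (f₀ 0 + d) / 2 := by
    have := h.wavg_le 1 i1
    rw [wavg_one_one] at this
    norm_num at this
    linarith
  have hΩ2 : (m + 1) * Ω < m * kappa₂ f₀ := by
    have := hΩ.2
    rw [lt_div_iff₀ (by positivity)] at this
    linarith
  -- The gap `ε` is a lower bound for `w - Ω`, where `w` is `wavg 1 f₀`; it is of size at least `f₀
  -- 0 / (m + 1)` up to a constant, whereas the oscillation `d` is at most `f₀ 0 / (10 m)`.
  set ε := f₀ 0 / 2 - Ω with hε_def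
  have hmε : 9 / 20 * f₀ 0 ≤ (m + 1) * ε := by nlinarith
  have hε : 0 < ε := by
    by_contra hneg
    nlinarith
  have hdε : d ≤ 2 * ε := by
    by_contra hneg
    nlinarith
  have hw : ∀ r ∈ Icc (0 : ℝ) 1, Ω - wavg 1 f₀ r ≤ -ε := fun r hr => by
    have := h.le_wavg 1 hr
    norm_num at this
    linarith
  have hw0 : ∀ r ∈ Icc (0 : ℝ) 1, Ω - wavg 1 f₀ r ≠ 0 := fun r hr => by
    have := hw r hr
    linarith
  have hF := h.isRadialSolution_sturm hw0 m
  obtain ⟨hF1, hFm⟩ := hF.one_le_and_monotoneOn (by omega) fun r hr =>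
    div_nonpos_of_nonneg_of_nonpos (h.pos.le.trans (h.le r ⟨hr.1, hr.2.le⟩))
      (by linarith [hw r ⟨hr.1.le, hr.2.le⟩])
  have hFpos : ∀ r ∈ Icc (0 : ℝ) 1, 0 < sturm f₀ m Ω r := fun r hr => by linarith [hF1 r hr]
  have hF0 : ∀ r ∈ Icc (0 : ℝ) 1, sturm f₀ m Ω r ≠ 0 := fun r hr => (hFpos r hr).ne'
  have hG : 0 < Gfun f₀ m Ω 1 := by
    rw [Gfun_one (by omega)]
    exact mul_pos (by linarith) (by linarith [hΩ.1])
  have hGle : 3 * Gfun f₀ m Ω 1 < kappa₂ f₀ := by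
    have hP := h.wavg_le (2 * m + 1) i1
    push_cast at hP
    rw [le_div_iff₀ (by linarith)] at hP
    have hGe : Gfun f₀ m Ω 1 = m * Ω - m * kappa₂ f₀ + (m + 1) * wavg (2 * m + 1) f₀ 1 := by
      rw [Gfun_one (by omega), singularValue, ← wavg_at_one]
      have : (m : ℝ) ≠ 0 := by linarith
      field_simp
      ring
    have h1 : Gfun f₀ m Ω 1 ≤ m * Ω - m * kappa₂ f₀ + (f₀ 0 + d) / 2 := by
      rw [hGe]; linarith
    -- By `(m+1)Ω < mκ₂` the left side is at most `f₀ 0 / 2 + (m+1)d/2`, and `(m+1)d ≤ 4/30 f₀ 0`.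
    -- With `m + 1 ≥ 4` this gives `3 G_m(1) ≤ 17/40 f₀ 0 < κ₂`.
    have h2 : (m + 1) * Gfun f₀ m Ω 1 ≤ 17 / 30 * f₀ 0 := by
      have h3 := mul_le_mul_of_nonneg_left h1 (by linarith : (0 : ℝ) ≤ m + 1)
      nlinarith
    nlinarith
  rw [h.transInt_eq (by omega) hw0 hF0 hζ hG.ne']
  apply intervalIntegral.intervalIntegral_pos_of_pos_on
    (intervalIntegrable_of_continuousOn (h.continuousOn_integrand hw0 hF0) i0 i1) ?_ zero_lt_one
  intro r hr
  have hr' : r ∈ Icc (0 : ℝ) 1 := ⟨hr.1.le, hr.2.le⟩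
  have hr2 : 0 < 1 - r ^ 2 := by nlinarith [hr.1, hr.2]
  have hcoef : coef f₀ D Ω r ≠ 0 :=
    div_ne_zero (h.pos.trans_le (h.le r ⟨hr.1, hr.2.le⟩)).ne' (hw0 r hr')
  refine mul_pos (abs_pos.2 hcoef) (mul_pos (pow_pos hr.1 _) (mul_pos (hFpos r hr') ?_))
  set F := sturm f₀ m Ω
  set Φ := varConst (2 * m + 1) F (fun τ => Ω - f₀ τ / 2) r
  -- Here `|Ω - f₀/2| ≤ ε + d/2 ≤ 2ε`. Monotonicity of `F` is used twice, inside the average and to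
  -- replace `1/F s` by `1/F r`, so that `F r * Φ` is bounded independently of the size of `F`.
  have hΦ : |Φ| ≤ 2 * ε / (2 * m + 2) / F r / 2 * (1 - r ^ 2) := by
    apply abs_varConst_le (2 * m + 1) hr'
    intro s hs
    have hs' : s ∈ Icc (0 : ℝ) 1 := ⟨hr.1.le.trans hs.1, hs.2⟩
    have hFs := hFpos s hs'
    have h1 := abs_wavg_le (2 * m + 1) (q := fun x => F x * (Ω - f₀ x / 2)) (B := F s * (2 * ε))
      hs'.1 (fun x hx => by
        have hx' : x ∈ Icc (0 : ℝ) 1 := ⟨hx.1, hx.2.trans hs'.2⟩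
        rw [abs_mul, abs_of_pos (hFpos x hx')]
        refine mul_le_mul (hFm hx' hs' hx.2) ?_ (abs_nonneg _) hFs.le
        rw [abs_le]
        have := h.mono i0 hx' hx.1
        have := h.mono hx' i1 hx'.2
        constructor <;> linarith)
    push_cast at h1
    calc |wavg (2 * m + 1) (fun x => F x * (Ω - f₀ x / 2)) s| / F s ^ 2
        ≤ F s * (2 * ε) / (2 * m + 1 + 1) / F s ^ 2 := by gcongr
      _ = 2 * ε / (2 * m + 2) / F s := by field_simp; ring
      _ ≤ 2 * ε / (2 * m + 2) / F r := by
        have := hFm hr' hs' hs.1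
        have := hFpos r hr'
        gcongr
  have hFΦ : F r * Φ ≤ 2 * ε / (4 * (m + 1)) * (1 - r ^ 2) := by
    have := mul_le_mul_of_nonneg_left ((le_abs_self _).trans hΦ) (hFpos r hr').le
    refine this.trans_eq ?_
    have := hF0 r hr'
    field_simp
    ring
  have hwr := hw r hr'
  have t1 : -(2 / (4 * (m + 1)) * (1 - r ^ 2)) ≤ F r * Φ / (Ω - wavg 1 f₀ r) := by
    rw [le_div_iff_of_neg (by linarith)]
    refine hFΦ.trans ?_
    have : 0 ≤ 2 / (4 * ((m : ℝ) + 1)) * (1 - r ^ 2) := by positivity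
    have := mul_le_mul_of_nonneg_left hwr this
    calc _ = -(2 / (4 * ((m : ℝ) + 1)) * (1 - r ^ 2) * -ε) := by ring
      _ ≤ _ := by linarith
  have hN : kappa₂ f₀ * (1 - r ^ 2) ≤ gDefect f₀ m r := by
    refine le_trans ?_ (h.le_gDefect m hr')
    have hq : (0 : ℝ) ≤ 1 / 4 - 1 / (2 * m + 4) := by
      rw [sub_nonneg]; apply one_div_le_one_div_of_le <;> linarith
    have : 0 ≤ (1 - r ^ 2) * ((m + 1) * r ^ 2 * (c / 2 * (1 / 4 - 1 / (2 * (m : ℝ) + 4)))) := by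
      have := h.pos
      positivity
    linarith
  have t2 : 3 * (1 - r ^ 2) < gDefect f₀ m r / Gfun f₀ m Ω 1 := by
    rw [lt_div_iff₀ hG]
    nlinarith
  have t3 := mul_lt_mul_of_pos_left t2 (by positivity : (0 : ℝ) < 1 / (4 * (m + 1)))
  have t4 : 0 < 1 / (4 * ((m : ℝ) + 1)) * (1 - r ^ 2) := by positivity
  rw [bracket]
  have e : 2 / (4 * ((m : ℝ) + 1)) * (1 - r ^ 2) = 2 * (1 / (4 * ((m : ℝ) + 1)) * (1 - r ^ 2)) := by
    ring
  have e3 : 1 / (4 * ((m : ℝ) + 1)) * (3 * (1 - r ^ 2))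
      = 3 * (1 / (4 * ((m : ℝ) + 1)) * (1 - r ^ 2)) := by ring
  linarith

end

/-! ### Negative profiles: estimates for a coefficient concentrated near `r = 1`. -/

section

variable {f₀ D : ℝ → ℝ} {c Ω : ℝ} {m k : ℕ} {μ F F' b : ℝ → ℝ}

/-- If `|μ| ≤ C / (δ + 1 - r²)` with `C²` small against `k² δ`, then the normalized radial
solution stays close to `1`. -/
lemma IsRadialSolution.abs_sub_one_le (hF : IsRadialSolution k μ F F') (hk : k ≠ 0)
    (hμ : ContinuousOn μ (Icc 0 1)) {C δ : ℝ} (hC : 0 ≤ C) (hδ : 0 < δ) (hδ1 : δ ≤ 1)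
    (hb : ∀ s ∈ Icc (0 : ℝ) 1, |μ s| ≤ C / (δ + 1 - s ^ 2))
    (hsmall : 32 * C ^ 2 ≤ (k + 1) ^ 2 * δ) {r : ℝ} (hr : r ∈ Icc (0 : ℝ) 1) :
    |F r - 1| ≤ 1 / 3 := by
  have i0 : (0 : ℝ) ∈ Icc (0 : ℝ) 1 := ⟨le_rfl, zero_le_one⟩
  obtain ⟨x, hx, hmax⟩ := isCompact_Icc.exists_isMaxOn ⟨0, i0⟩ hF.cont.abs
  set S := |F x|
  have hS0 : 0 ≤ S := abs_nonneg _
  have hS : ∀ y ∈ Icc (0 : ℝ) 1, |F y| ≤ S := fun y hy => hmax hy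
  have hpos : ∀ y ∈ Icc (0 : ℝ) 1, δ ≤ δ + 1 - y ^ 2 := fun y hy => by
    nlinarith [hy.1, hy.2]
  have hsδ := Real.sqrt_pos.2 hδ
  -- The flux identity gives `|F'| ≤ y C S / ((k+1)(δ + 1 - y²))`. Since `δ + 1 - y² ≥ √δ √(δ + 1 -
  -- y²)`, this is at most `A y / √(δ + 1 - y²)`, whose primitive `-A √(δ + 1 - y²)` varies by at
  -- most `√2 A ≤ S/4`.
  set A := C * S / ((k + 1) * √δ) with hA
  have hA0 : 0 ≤ A := by positivity
  have hd : ∀ y ∈ Ioo (0 : ℝ) 1, |F' y| ≤ A * (y / √(δ + 1 - y ^ 2)) := by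
    intro y hy
    have hy' : y ∈ Icc (0 : ℝ) 1 := ⟨hy.1.le, hy.2.le⟩
    have hby := hpos y hy'
    have hF'y : F' y = -(y * wavg k (fun s => μ s * F s) y) := by
      have h1 := hF.flux hk hμ hy'
      rw [← pow_succ_mul_wavg k (fun s => μ s * F s), pow_succ, mul_assoc, ← mul_neg] at h1
      exact mul_left_cancel₀ (pow_pos hy.1 k).ne' h1
    have h2 := abs_wavg_le k (q := fun s => μ s * F s) (B := C / (δ + 1 - y ^ 2) * S) hy.1.le
      (fun s hs => by
        have hs' : s ∈ Icc (0 : ℝ) 1 := ⟨hs.1, hs.2.trans hy'.2⟩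
        rw [abs_mul]
        refine mul_le_mul ((hb s hs').trans ?_) (hS s hs') (abs_nonneg _) ?_
        · have := pow_le_pow_left₀ hs.1 hs.2 2
          apply div_le_div_of_nonneg_left hC <;> linarith
        · exact div_nonneg hC (by linarith))
    rw [hF'y, abs_neg, abs_mul, abs_of_pos hy.1]
    have hsq : √δ * √(δ + 1 - y ^ 2) ≤ δ + 1 - y ^ 2 := by
      calc √δ * √(δ + 1 - y ^ 2) ≤ √(δ + 1 - y ^ 2) * √(δ + 1 - y ^ 2) := by gcongr
        _ = _ := Real.mul_self_sqrt (by linarith)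
    have hb0 : 0 < √(δ + 1 - y ^ 2) := Real.sqrt_pos.2 (by linarith)
    calc y * |wavg k (fun s => μ s * F s) y| ≤ y * (C / (δ + 1 - y ^ 2) * S / (k + 1)) :=
          mul_le_mul_of_nonneg_left h2 hy.1.le
      _ ≤ y * (C / (√δ * √(δ + 1 - y ^ 2)) * S / (k + 1)) := by
          have := hy.1
          gcongr
      _ = A * (y / √(δ + 1 - y ^ 2)) := by rw [hA]; field_simp
  have hV : ∀ y ∈ Ioo (0 : ℝ) 1, HasDerivAt (fun y => -(A * √(δ + 1 - y ^ 2)))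
      (A * (y / √(δ + 1 - y ^ 2))) y := by
    intro y hy
    have hb0 : δ + 1 - y ^ 2 ≠ 0 := by linarith [hpos y ⟨hy.1.le, hy.2.le⟩]
    refine ((((hasDerivAt_pow 2 y).const_sub (δ + 1)).sqrt hb0).const_mul A).neg.congr_deriv ?_
    have : √(δ + 1 - y ^ 2) ≠ 0 := (Real.sqrt_pos.2 (by
      linarith [hpos y ⟨hy.1.le, hy.2.le⟩])).ne'
    field_simp
    norm_num
  have cV : ContinuousOn (fun y : ℝ => -(A * √(δ + 1 - y ^ 2))) (Icc 0 1) := by fun_prop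
  have hle : ∀ y ∈ Icc (0 : ℝ) 1, |F y - 1| ≤ S / 4 := by
    intro y hy
    have u1 : F y - F 0 ≤ -(A * √(δ + 1 - y ^ 2)) - -(A * √(δ + 1 - 0 ^ 2)) := sub_le_sub_of_hasDerivAt_le hF.cont cV hF.hasDeriv hV
      (fun z hz => (le_abs_self _).trans (hd z hz)) i0 hy hy.1
    have u2 : -F y - -F 0 ≤ -(A * √(δ + 1 - y ^ 2)) - -(A * √(δ + 1 - 0 ^ 2)) :=
      sub_le_sub_of_hasDerivAt_le hF.cont.neg cV (fun z hz => (hF.hasDeriv z hz).neg) hV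
      (fun z hz => (neg_le_abs _).trans (hd z hz)) i0 hy hy.1
    have u3 : 0 ≤ A * √(δ + 1 - y ^ 2) := by positivity
    have u4 : A * √(δ + 1 - 0 ^ 2) ≤ S / 4 := by
      have hCs : 4 * C * √2 ≤ (k + 1) * √δ := by
        refine (sq_le_sq₀ (by positivity) (by positivity)).1 ?_
        rw [mul_pow, mul_pow, mul_pow, Real.sq_sqrt hδ.le, Real.sq_sqrt (by norm_num)]
        linarith
      have h2 : √(δ + 1 - 0 ^ 2) ≤ √2 := Real.sqrt_le_sqrt (by linarith)
      calc A * √(δ + 1 - 0 ^ 2) ≤ A * √2 := by gcongr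
        _ = (4 * C * √2) * (S / 4) / ((k + 1) * √δ) := by rw [hA]; ring
        _ ≤ ((k + 1) * √δ) * (S / 4) / ((k + 1) * √δ) := by gcongr
        _ = S / 4 := by field_simp
    rw [hF.zero] at u1 u2
    generalize A * √(δ + 1 - 0 ^ 2) = p at *
    generalize A * √(δ + 1 - y ^ 2) = q at *
    rw [abs_le]
    constructor <;> linarith
  -- The bound closes on itself: `S ≤ 1 + S/4`.
  have hS43 : S ≤ 4 / 3 := by
    have h1 := hle x hx
    have h2 : S ≤ |F x - 1| + 1 := by
      have := abs_add_le (F x - 1) 1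
      simpa using this
    linarith
  linarith [hle r hr]

lemma IsProfileSlope.kappa_sub_wavg_le (h : IsProfileSlope f₀ D c) {M : ℝ}
    (hM : ∀ r ∈ Icc (0 : ℝ) 1, |D r| ≤ M) {r : ℝ} (hr : r ∈ Icc (0 : ℝ) 1) :
    c / 8 * (1 - r ^ 2) ≤ kappa₂ f₀ - wavg 1 f₀ r ∧
      kappa₂ f₀ - wavg 1 f₀ r ≤ M / 8 * (1 - r ^ 2) := by
  have i0 : (0 : ℝ) ∈ Icc (0 : ℝ) 1 := ⟨le_rfl, zero_le_one⟩
  have i1 : (1 : ℝ) ∈ Icc (0 : ℝ) 1 := ⟨zero_le_one, le_rfl⟩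
  have hc : ContinuousOn (fun t => f₀ t - f₀ (t * r)) (Icc 0 1) :=
    h.continuousOn.sub (h.continuousOn.comp (by fun_prop) fun t ht => mul_mem_Icc ht hr)
  have ii := intervalIntegrable_of_continuousOn (continuousOn_pow_mul 1 hc) i0 i1
  have e : ∀ C : ℝ, C / 8 * (1 - r ^ 2) = ∫ t in (0 : ℝ)..1, t ^ 3 * (C / 2 * (1 - r ^ 2)) :=
    fun C => by rw [integral_pow_mul_const]; push_cast; ring
  have ic : ∀ C : ℝ, IntervalIntegrable (fun t : ℝ => t ^ 3 * C) MeasureTheory.volume 0 1 :=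
    fun C => (by fun_prop : Continuous fun t : ℝ => t ^ 3 * C).intervalIntegrable _ _
  rw [← wavg_one_one, h.wavg_sub_eq 1 hr, e, e]
  constructor
  · apply intervalIntegral.integral_mono_on zero_le_one (ic _) ii
    intro t ht
    have := h.le_sub (mul_mem_Icc ht hr) ht (mul_le_of_le_one_right ht.1 hr.2)
    have := mul_le_mul_of_nonneg_left this ht.1
    simp only [pow_one]
    linarith
  · apply intervalIntegral.integral_mono_on zero_le_one ii (ic _)
    intro t ht
    have := h.sub_le hM (mul_mem_Icc ht hr) ht (mul_le_of_le_one_right ht.1 hr.2)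
    have := mul_le_mul_of_nonneg_left this ht.1
    simp only [pow_one]
    linarith

lemma abs_coef_le {M c₁ : ℝ} (hc₁ : 0 < c₁) {δ r : ℝ} (hδ : 0 < δ) (hM : |D r| ≤ M)
    (hr : r ∈ Icc (0 : ℝ) 1) (hlow : c₁ * (δ + 1 - r ^ 2) ≤ Ω - wavg 1 f₀ r) :
    |coef f₀ D Ω r| ≤ M / c₁ / (δ + 1 - r ^ 2) := by
  have hp : 0 < δ + 1 - r ^ 2 := by nlinarith [hr.1, hr.2]
  have hp' := mul_pos hc₁ hp
  rw [coef, abs_div, abs_of_pos (hp'.trans_le hlow), div_div]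
  exact div_le_div₀ ((abs_nonneg _).trans hM) hM hp' hlow

/-- The contribution of `h_m^⋆` to the transversality integral is bounded. -/
lemma abs_integral_varConst_le
    (hF1 : ∀ r ∈ Icc (0 : ℝ) 1, |F r - 1| ≤ 1 / 3) {M c₁ B : ℝ} (hm : 1 ≤ m) (hc₁ : 0 < c₁)
    (hM : ∀ r ∈ Icc (0 : ℝ) 1, |D r| ≤ M) (hB : ∀ r ∈ Icc (0 : ℝ) 1, |b r| ≤ B)
    (hlow : ∀ r ∈ Icc (0 : ℝ) 1, c₁ * (1 / m + 1 - r ^ 2) ≤ Ω - wavg 1 f₀ r) :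
    |∫ r in (0 : ℝ)..1, |coef f₀ D Ω r| * (r ^ (2 * m + 1) * (F r *
        (F r * varConst (2 * m + 1) F b r / (Ω - wavg 1 f₀ r))))|
      ≤ M * B / c₁ ^ 2 / (m + 1) := by
  have i0 : (0 : ℝ) ∈ Icc (0 : ℝ) 1 := ⟨le_rfl, zero_le_one⟩
  have hm1 : (1 : ℝ) ≤ m := by exact_mod_cast hm
  have hδ : (0 : ℝ) < 1 / m := by positivity
  have hM0 : 0 ≤ M := (abs_nonneg _).trans (hM 0 i0)
  have hB0 : 0 ≤ B := (abs_nonneg _).trans (hB 0 i0)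
  have hFl : ∀ r ∈ Icc (0 : ℝ) 1, 2 / 3 ≤ F r ∧ F r ≤ 4 / 3 := fun r hr => by
    have := abs_le.1 (hF1 r hr)
    constructor <;> linarith
  -- The coefficient is at most of order `m`, the quotient `FΦ/(Ω - w)`, with `w` short for `wavg 1
  -- f₀`, is of order `1/m`, and the integral of `r^{2m+1}` supplies the final `1/m`.
  have hint : ∫ r in (0 : ℝ)..1, r ^ (2 * m + 1) * (M / c₁ * m * (4 / 3 * (B / c₁ / (m + 1))))
      ≤ M * B / c₁ ^ 2 / (m + 1) := by
    rw [integral_pow_mul_const]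
    push_cast
    have e : M / c₁ * m * (4 / 3 * (B / c₁ / (m + 1))) / (2 * m + 1 + 1)
        = M * B / c₁ ^ 2 / (m + 1) * (2 / 3 * (m / (m + 1))) := by
      field_simp
      ring
    rw [e]
    apply mul_le_of_le_one_right (by positivity)
    have : (m : ℝ) / (m + 1) ≤ 1 := by rw [div_le_one (by positivity)]; linarith
    linarith
  refine le_trans ?_ hint
  rw [← Real.norm_eq_abs]
  apply intervalIntegral.norm_integral_le_of_norm_le zero_le_one
  · refine Filter.Eventually.of_forall fun r hr => ?_
    have hr' : r ∈ Icc (0 : ℝ) 1 := ⟨hr.1.le, hr.2⟩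
    have hr2 : 0 ≤ 1 - r ^ 2 := by nlinarith [hr.1, hr.2]
    obtain ⟨f1, f2⟩ := hFl r hr'
    have hw := hlow r hr'
    have hw0 : 0 < Ω - wavg 1 f₀ r := lt_of_lt_of_le (mul_pos hc₁ (by linarith)) hw
    have hΦ : |varConst (2 * m + 1) F b r| ≤ 3 * B / (2 * m + 2) / 2 * (1 - r ^ 2) := by
      apply abs_varConst_le (2 * m + 1) hr'
      intro s hs
      have hs' : s ∈ Icc (0 : ℝ) 1 := ⟨hr.1.le.trans hs.1, hs.2⟩
      have h1 := abs_wavg_le (2 * m + 1) (q := fun x => F x * b x) (B := 4 / 3 * B)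
        hs'.1 (fun x hx => by
          have hx' : x ∈ Icc (0 : ℝ) 1 := ⟨hx.1, hx.2.trans hs'.2⟩
          obtain ⟨g1, g2⟩ := hFl x hx'
          rw [abs_mul, abs_of_pos (by linarith)]
          exact mul_le_mul g2 (hB x hx') (abs_nonneg _) (by norm_num))
      push_cast at h1
      obtain ⟨g1, g2⟩ := hFl s hs'
      have hsq : 4 / 9 ≤ F s ^ 2 := by nlinarith
      calc |wavg (2 * m + 1) (fun x => F x * b x) s| / F s ^ 2
          ≤ 4 / 3 * B / (2 * m + 1 + 1) / (4 / 9) := by gcongr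
        _ = 3 * B / (2 * m + 2) := by field_simp; ring
    have hFΦ : |F r * varConst (2 * m + 1) F b r / (Ω - wavg 1 f₀ r)| ≤ B / c₁ / (m + 1) := by
      rw [abs_div, abs_of_pos hw0, div_le_iff₀ hw0, abs_mul, abs_of_pos (by linarith)]
      calc F r * |varConst (2 * m + 1) F b r|
          ≤ 4 / 3 * (3 * B / (2 * m + 2) / 2 * (1 - r ^ 2)) :=
            mul_le_mul f2 hΦ (abs_nonneg _) (by norm_num)
        _ = B / c₁ / (m + 1) * (c₁ * (1 - r ^ 2)) := by field_simp; ring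
        _ ≤ B / c₁ / (m + 1) * (Ω - wavg 1 f₀ r) := by
            apply mul_le_mul_of_nonneg_left _ (by positivity)
            refine le_trans ?_ hw
            exact mul_le_mul_of_nonneg_left (by linarith) hc₁.le
    have hco : |coef f₀ D Ω r| ≤ M / c₁ * m := by
      refine (abs_coef_le hc₁ hδ (hM r hr') hr' hw).trans ?_
      rw [div_eq_mul_inv _ (1 / (m : ℝ) + 1 - r ^ 2)]
      apply mul_le_mul_of_nonneg_left _ (by positivity)
      rw [inv_le_comm₀ (by linarith) (by linarith), ← one_div]
      linarith
    have hrp : 0 ≤ r ^ (2 * m + 1) := pow_nonneg hr'.1 _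
    rw [Real.norm_eq_abs, abs_mul, abs_abs, abs_mul, abs_of_nonneg hrp, abs_mul,
      abs_of_pos (by linarith : 0 < F r)]
    calc |coef f₀ D Ω r| * (r ^ (2 * m + 1) *
          (F r * |F r * varConst (2 * m + 1) F b r / (Ω - wavg 1 f₀ r)|))
        ≤ (M / c₁ * m) * (r ^ (2 * m + 1) * (4 / 3 * (B / c₁ / (m + 1)))) := by gcongr
      _ = _ := by ring
  · exact (by fun_prop : Continuous fun r : ℝ =>
      r ^ (2 * m + 1) * (M / c₁ * m * (4 / 3 * (B / c₁ / (m + 1))))).intervalIntegrable _ _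

/-- Bernoulli's inequality: the weight `r^{2m+1}` does not decay on a window of width `1/(4m)`. -/
lemma quarter_le_pow (hm : 1 ≤ m) {r : ℝ} (hr : 1 - 1 / (4 * m) ≤ r) :
    1 / 4 ≤ r ^ (2 * m + 1) := by
  have hm1 : (1 : ℝ) ≤ m := by exact_mod_cast hm
  have h1 : 1 / (4 * (m : ℝ)) ≤ 1 / 4 := by
    apply one_div_le_one_div_of_le <;> linarith
  have h2 := one_add_mul_le_pow (a := -(1 / (4 * (m : ℝ)))) (by linarith) (2 * m + 1)
  have h3 := pow_le_pow_left₀ (by linarith : (0 : ℝ) ≤ 1 + -(1 / (4 * (m : ℝ))))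
    (by linarith : 1 + -(1 / (4 * (m : ℝ))) ≤ r) (2 * m + 1)
  have h4 : 1 + ((2 * m + 1 : ℕ) : ℝ) * -(1 / (4 * m)) = 1 / 2 - 1 / (4 * m) := by
    push_cast; field_simp; ring
  linarith

/-- A lower bound of the main part of the transversality integral for negative profiles. -/
lemma IsProfileSlope.le_integral_gDefect (h : IsProfileSlope f₀ D c)
    (hΩ : ∀ r ∈ Icc (0 : ℝ) 1, Ω - wavg 1 f₀ r ≠ 0) (hF : ContinuousOn F (Icc 0 1))
    (hF1 : ∀ r ∈ Icc (0 : ℝ) 1, |F r - 1| ≤ 1 / 3) {M c₁ E : ℝ} (hm : 2 ≤ m) (hc₁ : 0 < c₁)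
    (hE : 0 < E) (hM : ∀ r ∈ Icc (0 : ℝ) 1, |D r| ≤ M)
    (hlow : ∀ r ∈ Icc (0 : ℝ) 1, c₁ * (1 / m + 1 - r ^ 2) ≤ Ω - wavg 1 f₀ r)
    (hup : ∀ r ∈ Icc (0 : ℝ) 1, Ω - wavg 1 f₀ r ≤ E * (1 / m + 1 - r ^ 2))
    (hκ : |kappa₂ f₀| ≤ m * c / 128) :
    c ^ 2 / (1152 * E) / 32 - 4 / 3 * (M / c₁) * |kappa₂ f₀| / (2 * m + 2) ≤
      ∫ r in (0 : ℝ)..1, |coef f₀ D Ω r| * (r ^ (2 * m + 1) * (F r * gDefect f₀ m r)) := by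
  have i0 : (0 : ℝ) ∈ Icc (0 : ℝ) 1 := ⟨le_rfl, zero_le_one⟩
  have i1 : (1 : ℝ) ∈ Icc (0 : ℝ) 1 := ⟨zero_le_one, le_rfl⟩
  have hm2 : (2 : ℝ) ≤ m := by exact_mod_cast hm
  have hδ : (0 : ℝ) < 1 / m := by positivity
  have hM0 : 0 ≤ M := (abs_nonneg _).trans (hM 0 i0)
  have hc := h.pos
  have hFl : ∀ r ∈ Icc (0 : ℝ) 1, 2 / 3 ≤ F r ∧ F r ≤ 4 / 3 := fun r hr => by
    have := abs_le.1 (hF1 r hr)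
    constructor <;> linarith
  have hN : ∀ r ∈ Icc (0 : ℝ) 1,
      (1 - r ^ 2) * (kappa₂ f₀ + m * r ^ 2 * (c / 16)) ≤ gDefect f₀ m r := by
    intro r hr
    refine le_trans ?_ (h.le_gDefect m hr)
    have hr2 : 0 ≤ 1 - r ^ 2 := by nlinarith [hr.1, hr.2]
    have hq : (1 : ℝ) / 8 ≤ 1 / 4 - 1 / (2 * m + 4) := by
      have : (1 : ℝ) / (2 * m + 4) ≤ 1 / 8 := by apply one_div_le_one_div_of_le <;> linarith
      linarith
    apply mul_le_mul_of_nonneg_left _ hr2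
    have : m * r ^ 2 * (c / 16) ≤ (m + 1) * r ^ 2 * (c / 2 * (1 / 4 - 1 / (2 * (m : ℝ) + 4))) := by
      apply mul_le_mul _ _ (by positivity) (by positivity)
      · exact mul_le_mul_of_nonneg_right (by linarith) (sq_nonneg r)
      · nlinarith
    linarith
  set u : ℝ → ℝ := fun r => |coef f₀ D Ω r| * (r ^ (2 * m + 1) * (F r * gDefect f₀ m r))
  set C := 4 / 3 * (M / c₁) * |kappa₂ f₀|
  have hC0 : 0 ≤ C := by positivity
  have cu : ContinuousOn u (Icc 0 1) := (h.continuousOn_coef hΩ).abs.mul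
    (continuousOn_pow_mul _ (hF.mul (h.continuousOn_gDefect m)))
  -- Any negative part of `N` comes from `κ₂` and carries the factor `1 - r²`, which absorbs the
  -- growth of the coefficient. Its total is therefore `O(1/m)`.
  have hu1 : ∀ r ∈ Icc (0 : ℝ) 1, r ^ (2 * m + 1) * -C ≤ u r := by
    intro r hr
    have hr2 : 0 ≤ 1 - r ^ 2 := by nlinarith [hr.1, hr.2]
    obtain ⟨f1, f2⟩ := hFl r hr
    have hn : -((1 - r ^ 2) * |kappa₂ f₀|) ≤ gDefect f₀ m r := by
      refine le_trans ?_ (hN r hr)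
      have h1 : 0 ≤ m * r ^ 2 * (c / 16) := by positivity
      have h2 := neg_abs_le (kappa₂ f₀)
      calc _ = (1 - r ^ 2) * -|kappa₂ f₀| := by ring
        _ ≤ _ := mul_le_mul_of_nonneg_left (by linarith) hr2
    have hco : |coef f₀ D Ω r| * (1 - r ^ 2) ≤ M / c₁ := by
      calc |coef f₀ D Ω r| * (1 - r ^ 2)
          ≤ M / c₁ / (1 / m + 1 - r ^ 2) * (1 / m + 1 - r ^ 2) :=
            mul_le_mul (abs_coef_le hc₁ hδ (hM r hr) hr (hlow r hr)) (by linarith) hr2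
              (div_nonneg (by positivity) (by linarith))
        _ = M / c₁ := div_mul_cancel₀ _ (by linarith)
    have hp : 0 ≤ r ^ (2 * m + 1) := pow_nonneg hr.1 _
    calc r ^ (2 * m + 1) * -C
        = -(r ^ (2 * m + 1) * (4 / 3 * (M / c₁ * |kappa₂ f₀|))) := by simp only [C]; ring
      _ ≤ -(r ^ (2 * m + 1) * (F r * (|coef f₀ D Ω r| * (1 - r ^ 2) * |kappa₂ f₀|))) := by
          rw [neg_le_neg_iff]
          gcongr
      _ = |coef f₀ D Ω r| * (r ^ (2 * m + 1) * (F r * -((1 - r ^ 2) * |kappa₂ f₀|))) := by ring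
      _ ≤ u r := by
          have : 0 ≤ F r := by linarith
          simp only [u]
          gcongr
  set x₀ : ℝ := 1 - 1 / (4 * m) with hx₀
  have hq4 : 1 / (4 * (m : ℝ)) ≤ 1 / 4 := by apply one_div_le_one_div_of_le <;> linarith
  have hq0 : 0 < 1 / (4 * (m : ℝ)) := by positivity
  have hx₀m : x₀ ∈ Icc (0 : ℝ) 1 := ⟨by linarith, by linarith⟩
  -- On the window `1 - r² ≤ 1/(2m)`, so the coefficient is at least `cm/(3E/2)`; the weight is at
  -- least `1/4`, `F ≥ 2/3` and `N ≥ (1 - r) mc/128`. Integrating `m²(1 - r)` over the window gives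
  -- `1/32`.
  have hu2 : ∀ r ∈ Icc x₀ 1, c ^ 2 / (1152 * E) * m ^ 2 * (1 - r) ≤ u r := by
    intro r hr
    have hrh : 1 / 2 ≤ r := by linarith [hr.1]
    have hr' : r ∈ Icc (0 : ℝ) 1 := ⟨by linarith, hr.2⟩
    obtain ⟨f1, f2⟩ := hFl r hr'
    have hr1 : 0 ≤ 1 - r := by linarith [hr.2]
    have hn : (1 - r) * (m * c / 128) ≤ gDefect f₀ m r := by
      refine le_trans ?_ (hN r hr')
      have h2 := neg_abs_le (kappa₂ f₀)
      have h3 : m * c / 64 ≤ m * r ^ 2 * (c / 16) := by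
        have : 1 / 4 ≤ r ^ 2 := by nlinarith
        have := mul_le_mul_of_nonneg_left this (by positivity : 0 ≤ m * (c / 16))
        linarith
      exact mul_le_mul (by nlinarith [hr.2]) (by linarith) (by positivity)
        (by nlinarith [hr.2])
    have hco : c * m / (3 / 2 * E) ≤ |coef f₀ D Ω r| := by
      have hw : 0 < Ω - wavg 1 f₀ r :=
        lt_of_lt_of_le (mul_pos hc₁ (by nlinarith [hr.2])) (hlow r hr')
      have hDr := h.le r ⟨by linarith, hr.2⟩
      rw [coef, abs_div, abs_of_pos hw, abs_of_pos (hc.trans_le hDr), div_le_div_iff₀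
        (by positivity) hw]
      have h1 : Ω - wavg 1 f₀ r ≤ E * (3 / 2 * (1 / m)) := by
        refine (hup r hr').trans (mul_le_mul_of_nonneg_left ?_ hE.le)
        have e : 1 / (4 * (m : ℝ)) = 1 / 4 * (1 / m) := by field_simp
        nlinarith [hr.1, hr.2]
      calc c * m * (Ω - wavg 1 f₀ r) ≤ c * m * (E * (3 / 2 * (1 / m))) := by gcongr
        _ = c * (3 / 2 * E) := by field_simp
        _ ≤ _ := by gcongr
    have hp := quarter_le_pow (by omega : 1 ≤ m) hr.1
    calc c ^ 2 / (1152 * E) * m ^ 2 * (1 - r)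
        = c * m / (3 / 2 * E) * (1 / 4 * (2 / 3 * ((1 - r) * (m * c / 128)))) := by
          field_simp; ring
      _ ≤ u r := by
          simp only [u]
          gcongr
  have iu : ∀ x ∈ Icc (0 : ℝ) 1, ∀ y ∈ Icc (0 : ℝ) 1,
      IntervalIntegrable u MeasureTheory.volume x y := fun x hx y hy =>
    intervalIntegrable_of_continuousOn cu hx hy
  have ip : ∀ x y, IntervalIntegrable (fun r : ℝ => r ^ (2 * m + 1) * C) MeasureTheory.volume x y :=
    fun x y => (by fun_prop : Continuous fun r : ℝ => r ^ (2 * m + 1) * C).intervalIntegrable _ _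
  have s1 : -(C / (2 * m + 2)) ≤ ∫ r in (0 : ℝ)..x₀, u r := by
    have a1 : ∫ r in (0 : ℝ)..x₀, r ^ (2 * m + 1) * C
        ≤ ∫ r in (0 : ℝ)..1, r ^ (2 * m + 1) * C := by
      rw [← intervalIntegral.integral_add_adjacent_intervals (ip 0 x₀) (ip x₀ 1)]
      have : 0 ≤ ∫ r in x₀..1, r ^ (2 * m + 1) * C :=
        intervalIntegral.integral_nonneg hx₀m.2 fun r hr =>
          mul_nonneg (pow_nonneg (hx₀m.1.trans hr.1) _) hC0
      linarith
    have a2 : ∫ r in (0 : ℝ)..x₀, -(r ^ (2 * m + 1) * C) ≤ ∫ r in (0 : ℝ)..x₀, u r := by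
      apply intervalIntegral.integral_mono_on hx₀m.1 (ip 0 x₀).neg (iu 0 i0 x₀ hx₀m)
      intro r hr
      change -(r ^ (2 * m + 1) * C) ≤ u r
      rw [← mul_neg]
      exact hu1 r ⟨hr.1, hr.2.trans hx₀m.2⟩
    rw [integral_pow_mul_const] at a1
    rw [intervalIntegral.integral_neg] at a2
    push_cast at a1
    have e : (2 * (m : ℝ) + 1 + 1) = 2 * m + 2 := by ring
    rw [e] at a1
    linarith
  have s2 : c ^ 2 / (1152 * E) / 32 ≤ ∫ r in x₀..1, u r := by
    have e : ∫ r in x₀..1, c ^ 2 / (1152 * E) * m ^ 2 * (1 - r) = c ^ 2 / (1152 * E) / 32 := by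
      rw [intervalIntegral.integral_const_mul, intervalIntegral.integral_sub
        intervalIntegrable_const intervalIntegral.intervalIntegrable_id,
        intervalIntegral.integral_const, integral_id, hx₀]
      simp only [smul_eq_mul]
      field_simp
      ring
    rw [← e]
    apply intervalIntegral.integral_mono_on hx₀m.2 _ (iu x₀ hx₀m 1 i1) hu2
    exact (by fun_prop : Continuous fun r : ℝ =>
      c ^ 2 / (1152 * E) * m ^ 2 * (1 - r)).intervalIntegrable _ _
  rw [← intervalIntegral.integral_add_adjacent_intervals (iu 0 i0 x₀ hx₀m) (iu x₀ hx₀m 1 i1)]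
  linarith

end

/-! ### Negative profiles: divergence of the transversality integral. -/

section

variable {f₀ D : ℝ → ℝ} {c Ω : ℝ} {m : ℕ}

/-- For negative profiles the transversality integral is very negative when `Ω` is slightly
below the singular value. -/
theorem IsProfileSlope.transInt_le (h : IsProfileSlope f₀ D c) {M c₁ E B : ℝ} (hm : 2 ≤ m)
    (hc₁ : 0 < c₁) (hE : 0 < E) (hM : ∀ r ∈ Icc (0 : ℝ) 1, |D r| ≤ M)
    (hlow : ∀ r ∈ Icc (0 : ℝ) 1, c₁ * (1 / m + 1 - r ^ 2) ≤ Ω - wavg 1 f₀ r)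
    (hup : ∀ r ∈ Icc (0 : ℝ) 1, Ω - wavg 1 f₀ r ≤ E * (1 / m + 1 - r ^ 2))
    (hB : ∀ r ∈ Icc (0 : ℝ) 1, |Ω - f₀ r / 2| ≤ B) (hsmall : 8 * (M / c₁) ^ 2 ≤ m)
    (hκ : |kappa₂ f₀| ≤ m * c / 128)
    (hC : 4 / 3 * (M / c₁) * |kappa₂ f₀| ≤ m * (c ^ 2 / (1152 * E) / 32))
    (hG : Gfun f₀ m Ω 1 < 0) (hζ : zeta f₀ m Ω = 0) :
    4 * ((m : ℝ) + 1) * transInt f₀ m Ω ≤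
      4 * (M * B / c₁ ^ 2) - c ^ 2 / (1152 * E) / 64 / -Gfun f₀ m Ω 1 := by
  have i0 : (0 : ℝ) ∈ Icc (0 : ℝ) 1 := ⟨le_rfl, zero_le_one⟩
  have i1 : (1 : ℝ) ∈ Icc (0 : ℝ) 1 := ⟨zero_le_one, le_rfl⟩
  have hm2 : (2 : ℝ) ≤ m := by exact_mod_cast hm
  have hδ : (0 : ℝ) < 1 / m := by positivity
  have hδ1 : (1 : ℝ) / m ≤ 1 := by rw [div_le_one (by linarith)]; linarith
  have hM0 : 0 ≤ M := (abs_nonneg _).trans (hM 0 i0)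
  have hw0 : ∀ r ∈ Icc (0 : ℝ) 1, Ω - wavg 1 f₀ r ≠ 0 := fun r hr =>
    (lt_of_lt_of_le (mul_pos hc₁ (by nlinarith [hr.1, hr.2])) (hlow r hr)).ne'
  have hF := h.isRadialSolution_sturm hw0 m
  have hF1 : ∀ r ∈ Icc (0 : ℝ) 1, |sturm f₀ m Ω r - 1| ≤ 1 / 3 := fun r hr =>
    hF.abs_sub_one_le (by omega) (h.continuousOn_coef hw0) (C := M / c₁) (by positivity) hδ hδ1
      (fun s hs => abs_coef_le hc₁ hδ (hM s hs) hs (hlow s hs)) (by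
        push_cast
        have e : (2 * (m : ℝ) + 1 + 1) ^ 2 * (1 / m) = 4 * (m + 2 + 1 / m) := by
          field_simp; ring
        rw [e]
        linarith) hr
  have hF0 : ∀ r ∈ Icc (0 : ℝ) 1, sturm f₀ m Ω r ≠ 0 := fun r hr => by
    have := abs_le.1 (hF1 r hr)
    linarith
  have b1 := (abs_le.1 (abs_integral_varConst_le (m := m) (f₀ := f₀) (D := D) (Ω := Ω)
    hF1 (by omega) hc₁ hM hB hlow)).2
  have b2 := h.le_integral_gDefect hw0 hF.cont hF1 hm hc₁ hE hM hlow hup hκ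
  set F := sturm f₀ m Ω
  have hb : ContinuousOn (fun τ => Ω - f₀ τ / 2) (Icc 0 1) :=
    continuousOn_const.sub (h.continuousOn.div_const 2)
  have c1 : ContinuousOn (fun r => |coef f₀ D Ω r| * (r ^ (2 * m + 1) * (F r *
      (F r * varConst (2 * m + 1) F (fun τ => Ω - f₀ τ / 2) r / (Ω - wavg 1 f₀ r)))))
      (Icc 0 1) :=
    (h.continuousOn_coef hw0).abs.mul (continuousOn_pow_mul _ (hF.cont.mul
      ((hF.cont.mul (continuousOn_varConst _ hF.cont hb hF0)).div
        (continuousOn_const.sub (continuousOn_wavg 1 h.continuousOn)) hw0)))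
  have c2 : ContinuousOn (fun r => |coef f₀ D Ω r| *
      (r ^ (2 * m + 1) * (F r * gDefect f₀ m r))) (Icc 0 1) := (h.continuousOn_coef hw0).abs.mul
    (continuousOn_pow_mul _ (hF.cont.mul (h.continuousOn_gDefect m)))
  have e : transInt f₀ m Ω = (∫ r in (0 : ℝ)..1, |coef f₀ D Ω r| * (r ^ (2 * m + 1) * (F r *
      (F r * varConst (2 * m + 1) F (fun τ => Ω - f₀ τ / 2) r / (Ω - wavg 1 f₀ r)))))
      + 1 / (4 * (m + 1)) / Gfun f₀ m Ω 1 * ∫ r in (0 : ℝ)..1, |coef f₀ D Ω r| *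
        (r ^ (2 * m + 1) * (F r * gDefect f₀ m r)) := by
    rw [h.transInt_eq (by omega) hw0 hF0 hζ hG.ne, ← intervalIntegral.integral_const_mul,
      ← intervalIntegral.integral_add (intervalIntegrable_of_continuousOn c1 i0 i1)
        ((intervalIntegrable_of_continuousOn c2 i0 i1).const_mul _)]
    congr 1
    ext r
    rw [bracket]
    ring
  set T := ∫ r in (0 : ℝ)..1, |coef f₀ D Ω r| * (r ^ (2 * m + 1) * (F r *
      (F r * varConst (2 * m + 1) F (fun τ => Ω - f₀ τ / 2) r / (Ω - wavg 1 f₀ r))))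
  set X := ∫ r in (0 : ℝ)..1, |coef f₀ D Ω r| * (r ^ (2 * m + 1) * (F r * gDefect f₀ m r))
  have hX : c ^ 2 / (1152 * E) / 64 ≤ X := by
    refine le_trans ?_ b2
    have : 4 / 3 * (M / c₁) * |kappa₂ f₀| / (2 * m + 2) ≤ c ^ 2 / (1152 * E) / 64 := by
      rw [div_le_iff₀ (by positivity)]
      have : 0 ≤ c ^ 2 / (1152 * E) / 64 := by positivity
      linarith
    linarith
  have e2 : 4 * ((m : ℝ) + 1) * transInt f₀ m Ω
      = 4 * (m + 1) * T - X / -Gfun f₀ m Ω 1 := by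
    have := hG.ne
    rw [e]
    field_simp
    ring
  have t1 : 4 * ((m : ℝ) + 1) * T ≤ 4 * (M * B / c₁ ^ 2) := by
    rw [le_div_iff₀ (by positivity)] at b1
    linarith
  have t2 : c ^ 2 / (1152 * E) / 64 / -Gfun f₀ m Ω 1 ≤ X / -Gfun f₀ m Ω 1 :=
    div_le_div_of_nonneg_right hX (by linarith)
  rw [e2]
  linarith

open Filter in
/-- For negative profiles `(m + 1) |𝕀_m|` tends to infinity, uniformly over the admissible zeros
of the dispersion function. -/
theorem IsProfileSlope.eventually_le_abs_transInt (h : IsProfileSlope f₀ D c)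
    (hf : ∀ r ∈ Icc (0 : ℝ) 1, f₀ r < 0) {a : ℝ} (ha : 1 < a) (K : ℝ) :
    ∀ᶠ m : ℕ in atTop, ∀ Ω ∈ Ioo (singularValue f₀ m - (m : ℝ) ^ (-a)) (singularValue f₀ m),
      zeta f₀ m Ω = 0 → K ≤ 4 * ((m : ℝ) + 1) * |transInt f₀ m Ω| := by
  have i0 : (0 : ℝ) ∈ Icc (0 : ℝ) 1 := ⟨le_rfl, zero_le_one⟩
  have i1 : (1 : ℝ) ∈ Icc (0 : ℝ) 1 := ⟨zero_le_one, le_rfl⟩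
  have hc := h.pos
  obtain ⟨M, hM⟩ := isCompact_Icc.exists_bound_of_continuousOn h.cont
  simp only [Real.norm_eq_abs] at hM
  have hM0 : 0 ≤ M := (abs_nonneg _).trans (hM 0 i0)
  have h0 := hf 0 i0
  have h1 := hf 1 i1
  -- Bounding `f₀` by its end values gives `2e/m ≤ Ω̂_m - κ₂ ≤ E₀/m`. Once `m^{1-a} ≤ e`, the
  -- admissible `Ω` lose at most `e/m` and stay at distance at least `e/m` above `κ₂`.
  set e := -f₀ 1 / 4 with he
  have he0 : 0 < e := by linarith
  set E₀ := -f₀ 0 / 2 with hE₀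
  have hE₀0 : 0 < E₀ := by linarith
  set c₁ := min e (c / 8)
  have hc₁ : 0 < c₁ := lt_min he0 (by linarith)
  set E := max E₀ (M / 8)
  have hE : 0 < E := hE₀0.trans_le (le_max_left _ _)
  set B := |kappa₂ f₀| + 2 * E₀
  set L := c ^ 2 / (1152 * E) with hL
  have hL0 : 0 < L := by positivity
  have tc := tendsto_natCast_atTop_atTop (R := ℝ)
  have tneg : Tendsto (fun m : ℕ => (m : ℝ) ^ (1 - a)) atTop (nhds 0) := by
    have := (tendsto_rpow_neg_atTop (by linarith : 0 < a - 1)).comp tc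
    refine this.congr fun m => ?_
    simp
  have tpos : Tendsto (fun m : ℕ => (m : ℝ) ^ (a - 1)) atTop atTop :=
    (tendsto_rpow_atTop (by linarith : 0 < a - 1)).comp tc
  filter_upwards [eventually_ge_atTop 2, tneg.eventually_le_const he0,
    tc.eventually_ge_atTop (8 * (M / c₁) ^ 2), tc.eventually_ge_atTop (128 * |kappa₂ f₀| / c),
    tc.eventually_ge_atTop (4 / 3 * (M / c₁) * |kappa₂ f₀| / (L / 32)),
    tpos.eventually_ge_atTop ((K + 4 * (M * B / c₁ ^ 2)) / (L / 64))]
    with m hm hme hsmall hκ hC hK Ω hΩ hζ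
  have hm2 : (2 : ℝ) ≤ m := by exact_mod_cast hm
  have hm0 : (0 : ℝ) < m := by linarith
  have hmm : (m : ℝ) ^ (1 - a) = m * (m : ℝ) ^ (-a) := by
    rw [sub_eq_add_neg, Real.rpow_add hm0, Real.rpow_one]
  have hme' : (m : ℝ) ^ (-a) ≤ e / m := by
    rw [le_div_iff₀ hm0]
    linarith
  have hP1 := h.wavg_le (2 * m + 1) i1
  have hP2 := h.le_wavg (2 * m + 1) i1
  push_cast at hP1 hP2
  have hS : singularValue f₀ m = kappa₂ f₀ - (m + 1) / m * wavg (2 * m + 1) f₀ 1 := by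
    rw [singularValue, wavg_at_one]
  have hS1 : kappa₂ f₀ + 2 * e / m ≤ singularValue f₀ m := by
    have := mul_le_mul_of_nonneg_left hP1 (by positivity : (0 : ℝ) ≤ (m + 1) / m)
    have e1 : ((m : ℝ) + 1) / m * (f₀ 1 / (2 * m + 1 + 1)) = -(2 * e / m) := by
      rw [he]; field_simp; ring
    rw [hS]
    linarith
  have hS2 : singularValue f₀ m ≤ kappa₂ f₀ + E₀ / m := by
    have := mul_le_mul_of_nonneg_left hP2 (by positivity : (0 : ℝ) ≤ (m + 1) / m)
    have e1 : ((m : ℝ) + 1) / m * (f₀ 0 / (2 * m + 1 + 1)) = -(E₀ / m) := by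
      rw [hE₀]; field_simp; ring
    rw [hS]
    linarith
  have hΩ1 : e / m ≤ Ω - kappa₂ f₀ := by
    have := hΩ.1
    have e1 : 2 * e / m = e / m + e / m := by ring
    linarith
  have hΩ2 : Ω - kappa₂ f₀ ≤ E₀ / m := by linarith [hΩ.2]
  have hlow : ∀ r ∈ Icc (0 : ℝ) 1, c₁ * (1 / m + 1 - r ^ 2) ≤ Ω - wavg 1 f₀ r := by
    intro r hr
    have hr2 : 0 ≤ 1 - r ^ 2 := by nlinarith [hr.1, hr.2]
    have u1 := (h.kappa_sub_wavg_le hM hr).1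
    have u2 : c₁ * (1 / m) ≤ e * (1 / m) :=
      mul_le_mul_of_nonneg_right (min_le_left _ _) (by positivity)
    have u3 : c₁ * (1 - r ^ 2) ≤ c / 8 * (1 - r ^ 2) :=
      mul_le_mul_of_nonneg_right (min_le_right _ _) hr2
    have e1 : e / m = e * (1 / m) := by ring
    linarith
  have hup : ∀ r ∈ Icc (0 : ℝ) 1, Ω - wavg 1 f₀ r ≤ E * (1 / m + 1 - r ^ 2) := by
    intro r hr
    have hr2 : 0 ≤ 1 - r ^ 2 := by nlinarith [hr.1, hr.2]
    have u1 := (h.kappa_sub_wavg_le hM hr).2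
    have u2 : E₀ * (1 / m) ≤ E * (1 / m) :=
      mul_le_mul_of_nonneg_right (le_max_left _ _) (by positivity)
    have u3 : M / 8 * (1 - r ^ 2) ≤ E * (1 - r ^ 2) :=
      mul_le_mul_of_nonneg_right (le_max_right _ _) hr2
    have e1 : E₀ / m = E₀ * (1 / m) := by ring
    linarith
  have hB : ∀ r ∈ Icc (0 : ℝ) 1, |Ω - f₀ r / 2| ≤ B := by
    intro r hr
    have v1 := hf r hr
    have v2 := h.mono i0 hr hr.1
    have v3 : E₀ / m ≤ E₀ := div_le_self hE₀0.le (by linarith)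
    have v4 : 0 ≤ e / m := by positivity
    have v5 := abs_le.1 (le_refl |kappa₂ f₀|)
    rw [abs_le]
    simp only [B]
    constructor <;> linarith
  have hGe := Gfun_one (f₀ := f₀) (Ω := Ω) (by omega : 1 ≤ m)
  have hG : Gfun f₀ m Ω 1 < 0 := by
    rw [hGe]
    exact mul_neg_of_pos_of_neg hm0 (by linarith [hΩ.2])
  have hG2 : -Gfun f₀ m Ω 1 ≤ (m : ℝ) ^ (1 - a) := by
    rw [hGe, hmm, ← mul_neg]
    exact mul_le_mul_of_nonneg_left (by linarith [hΩ.1]) hm0.le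
  rw [div_le_iff₀ (by positivity)] at hκ hC hK
  have key := h.transInt_le hm hc₁ hE hM hlow hup hB hsmall (by linarith) hC hG hζ
  -- Proximity to the singular value, `-G_m(1) ≤ m^{1-a}`, is what produces the divergence.
  have hfin : (m : ℝ) ^ (a - 1) * (L / 64) ≤ L / 64 / -Gfun f₀ m Ω 1 := by
    rw [le_div_iff₀ (by linarith)]
    have hone : (m : ℝ) ^ (a - 1) * (m : ℝ) ^ (1 - a) = 1 := by
      rw [← Real.rpow_add hm0]; simp
    calc (m : ℝ) ^ (a - 1) * (L / 64) * -Gfun f₀ m Ω 1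
        ≤ (m : ℝ) ^ (a - 1) * (L / 64) * (m : ℝ) ^ (1 - a) := by gcongr
      _ = (m : ℝ) ^ (a - 1) * (m : ℝ) ^ (1 - a) * (L / 64) := by ring
      _ = L / 64 := by rw [hone, one_mul]
  have habs := mul_le_mul_of_nonneg_left (neg_le_abs (transInt f₀ m Ω))
    (by positivity : (0 : ℝ) ≤ 4 * ((m : ℝ) + 1))
  linarith

end

end

end RadialEuler

theorem proposition5p3 (β : ℝ) (hβ : β ∈ Set.Ioo (0 : ℝ) 1) (f₀ : ℝ → ℝ)
    (hsmooth : RadialEuler.SmoothProfile β f₀) (hmono : RadialEuler.MonotoneProfile f₀) :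
    ((∀ r ∈ Set.Icc (0 : ℝ) 1, 0 < f₀ r) →
      ∀ m : ℕ, 3 ≤ m → (m : ℝ) ≤ 1 / 10 * (f₀ 0 / (f₀ 1 - f₀ 0)) →
        ∀ Ω ∈ Set.Ioo (RadialEuler.singularValue f₀ m)
            ((m : ℝ) * RadialEuler.kappa₂ f₀ / (m + 1)),
          RadialEuler.zeta f₀ m Ω = 0 → RadialEuler.transInt f₀ m Ω ≠ 0) ∧
    ((∀ r ∈ Set.Icc (0 : ℝ) 1, f₀ r < 0) →
      ∀ a ∈ Set.Ioo (1 : ℝ) 2,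
        (∃ m₀ : ℕ, 1 ≤ m₀ ∧ ∀ m : ℕ, m₀ ≤ m →
          ∀ Ω ∈ Set.Ioo (RadialEuler.singularValue f₀ m - (m : ℝ) ^ (-a))
              (RadialEuler.singularValue f₀ m),
            RadialEuler.zeta f₀ m Ω = 0 → RadialEuler.transInt f₀ m Ω ≠ 0) ∧
        (∀ K : ℝ, ∃ m₀ : ℕ, 1 ≤ m₀ ∧ ∀ m : ℕ, m₀ ≤ m →
          ∀ Ω ∈ Set.Ioo (RadialEuler.singularValue f₀ m - (m : ℝ) ^ (-a))
              (RadialEuler.singularValue f₀ m),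
            RadialEuler.zeta f₀ m Ω = 0 →
              K ≤ 4 * ((m : ℝ) + 1) * |RadialEuler.transInt f₀ m Ω|)) := by
  obtain ⟨D, c, h⟩ := RadialEuler.exists_isProfileSlope hsmooth hmono
  refine ⟨fun hf m hm hmf Ω hΩ hζ =>
    (h.transInt_pos (hf 0 ⟨le_rfl, zero_le_one⟩) hm hmf hΩ hζ).ne', fun hf a ha => ?_⟩
  have key : ∀ K : ℝ, ∃ m₀ : ℕ, 1 ≤ m₀ ∧ ∀ m : ℕ, m₀ ≤ m →
      ∀ Ω ∈ Set.Ioo (RadialEuler.singularValue f₀ m - (m : ℝ) ^ (-a))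
          (RadialEuler.singularValue f₀ m),
        RadialEuler.zeta f₀ m Ω = 0 →
          K ≤ 4 * ((m : ℝ) + 1) * |RadialEuler.transInt f₀ m Ω| := by
    intro K
    obtain ⟨N, hN⟩ := Filter.eventually_atTop.1 (h.eventually_le_abs_transInt hf ha.1 K)
    exact ⟨max N 1, le_max_right _ _, fun m hm => hN m (le_of_max_le_left hm)⟩
  refine ⟨?_, key⟩
  -- Any positive lower bound excludes a zero.
  obtain ⟨m₀, h1, hm₀⟩ := key 1
  refine ⟨m₀, h1, fun m hm Ω hΩ hζ h0 => ?_⟩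
  have := hm₀ m hm Ω hΩ hζ
  rw [h0, abs_zero, mul_zero] at this
  exact absurd this (by norm_num)
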